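/- **General graph model.** A simple unweighted graph $G=(V,E)$ without isolated vertices is given by its number $n$ of vertices and three oracles: the vertex oracle (returns the $i$-th vertex), the degree oracle (returns $d(v)$), and the edge oracle (returns the $i$-th neighbour of $v$, or reports that $d(v)<i$). A randomized algorithm queries the oracles adaptively, each oracle call counting as one query, and outputs a random weighted graph $\tilde G$ on $V$ with nonnegative weights. **Probabilistic cut sparsifiers.** For $U\subseteq V$ let $\mathrm{cut}_G(U)$ be the total weight of the edges of $G$ between $U$ and $V\setminus U$ (each edge of an unweighted graph has weight $1$). For $p\in(0,1)$, a random weighted graph $\tilde G$ on $V$ is a probabilistic $(\varepsilon,\delta)$ cut sparsifier of $G$ with probability level $p$ if 1. with probability at least $p$, $(1-\varepsilon)\,\mathrm{cut}_G(U)\le \mathrm{cut}_{\tilde G}(U)$ holds for all $U\subseteq V$ simultaneously, and 2. for each fixed $U\subseteq V$, $\mathrm{cut}_{\tilde G}(U)\le(1+\varepsilon)\,\mathrm{cut}_G(U)+\delta|U|$ holds with probability at least $p$. **Theorem.** There is an absolute constant $p<1$ such that for every $\varepsilon_1<1$ there are constants $c,C>0$, depending only on $\varepsilon_1$, with the following property.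 Let $0<\varepsilon\le\varepsilon_1$, let $\delta>0$, and let $n\ge C\left(\frac1{\varepsilon^2}+\frac1\delta+\frac\delta\varepsilon\right)$ be an integer. Consider the class of all graphs in the general graph model (with arbitrary orders of the vertices and of the neighbours) that have $n$ vertices, no isolated vertex, at least $c\left(\frac n{\varepsilon^2}+\frac n\delta\right)$ edges and at most $C\left(\frac n{\varepsilon^2}+\frac n\delta+\frac{n\delta}\varepsilon\right)$ edges. If the output of a randomized algorithm is a probabilistic $(\varepsilon,\delta)$ cut sparsifier with probability level $p$ of every input from this class, then on some input from this class the expected number of its queries is at least $c\left(\frac n{\varepsilon^2}+\frac n\delta\right)$. In particular, constructing a probabilistic $(\varepsilon,\delta)$ cut sparsifier takes $\Omega\left(\frac n{\varepsilon^2}+\frac n\delta\right)$ queries for graphs with $n$ vertices and $\Omega\left(\frac n{\varepsilon^2}+\frac n\delta\right)$ edges (and $\Theta$ of this many edges as long as $\delta\le 1/\varepsilon$). -/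

import Mathlib

open MeasureTheory
open scoped NNReal

/-- A weighted undirected graph on the vertex set `V`: every unordered pair carries a nonnegative
weight, and the edges are the pairs of positive weight. The values on the diagonal play no role,
because no loop ever crosses a cut. -/
abbrev WeightedGraph (V : Type*) : Type _ := Sym2 V → ℝ≥0

/-- The cut value of `U`: the total weight of the edges with one end in `U` and one outside. -/
def WeightedGraph.cut {V : Type*} [Fintype V] [DecidableEq V]
    (w : WeightedGraph V) (U : Finset V) : ℝ :=
  ∑ u ∈ U, ∑ v ∈ Uᶜ, (w s(u, v) : ℝ)

open Classical in
/-- An unweighted graph, seen as a weighted graph in which all edges have weight `1`. -/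
noncomputable def WeightedGraph.ofSimpleGraph {V : Type*} (G : SimpleGraph V) : WeightedGraph V :=
  fun e => if e ∈ G.edgeSet then 1 else 0

/-- The random weighted graph `H` is a probabilistic `(ε, δ)` cut sparsifier of the unweighted
graph `G`, where "with high probability" means "with probability at least `p`":
with high probability the lower bound holds for all vertex sets simultaneously, and
for each single vertex set the upper bound holds with high probability. -/
def IsProbCutSparsifier {V : Type*} [Fintype V] [DecidableEq V] {Ω : Type*} [MeasurableSpace Ω]
    (p ε δ : ℝ) (G : SimpleGraph V) (μ : Measure Ω) (H : Ω → WeightedGraph V) : Prop :=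
  p ≤ μ.real {ω | ∀ U : Finset V,
      (1 - ε) * (WeightedGraph.ofSimpleGraph G).cut U ≤ (H ω).cut U} ∧
  ∀ U : Finset V, p ≤ μ.real {ω |
      (H ω).cut U ≤ (1 + ε) * (WeightedGraph.ofSimpleGraph G).cut U + δ * (U.card : ℝ)}

/-- A graph with `n` vertices as it is represented in the general graph model.
The vertex names are the elements of `Fin n`. -/
structure GraphOracle (n : ℕ) where
  /-- the graph itself -/
  graph : SimpleGraph (Fin n)
  /-- the vertex oracle: `vert i` is the `i`-th vertex -/
  vert : Fin n ≃ Fin n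
  /-- the degree oracle; `nbr` forces `deg v` to be the number of neighbours of `v` -/
  deg : Fin n → ℕ
  /-- the edge oracle: `nbr v i` is the `i`-th neighbour of `v` (counted from `0`) -/
  nbr : (v : Fin n) → Fin (deg v) ≃ graph.neighborSet v

/-- The answer to the edge query `(v, i)`; it is `none` if `v` has no `i`-th neighbour. -/
def GraphOracle.edgeAnswer {n : ℕ} (I : GraphOracle n) (v : Fin n) (i : ℕ) : Option (Fin n) :=
  if h : i < I.deg v then some (I.nbr v ⟨i, h⟩ : Fin n) else none

/-- A deterministic adaptive algorithm in the general graph model (for inputs with `n` vertices):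
it either stops with an output, or makes one query and goes on depending on the answer. There is
no restriction on the computation done between two queries. -/
inductive QueryAlg (n : ℕ) (α : Type) : Type
  | output (a : α) : QueryAlg n α
  | vertexQuery (i : Fin n) (next : Fin n → QueryAlg n α) : QueryAlg n α
  | degreeQuery (v : Fin n) (next : ℕ → QueryAlg n α) : QueryAlg n α
  | edgeQuery (v : Fin n) (i : ℕ) (next : Option (Fin n) → QueryAlg n α) : QueryAlg n α

/-- The output of the algorithm on the input `I`. -/
def QueryAlg.run {n : ℕ} {α : Type} (I : GraphOracle n) : QueryAlg n α → α
  | .output a => a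
  | .vertexQuery i next => (next (I.vert i)).run I
  | .degreeQuery v next => (next (I.deg v)).run I
  | .edgeQuery v i next => (next (I.edgeAnswer v i)).run I

/-- The number of queries that the algorithm makes on the input `I`. -/
def QueryAlg.numQueries {n : ℕ} {α : Type} (I : GraphOracle n) : QueryAlg n α → ℕ
  | .output _ => 0
  | .vertexQuery i next => (next (I.vert i)).numQueries I + 1
  | .degreeQuery v next => (next (I.deg v)).numQueries I + 1
  | .edgeQuery v i next => (next (I.edgeAnswer v i)).numQueries I + 1

/-- A randomized algorithm in the general graph model with random seed `ω ∈ Ω`, whose outputs are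
weighted graphs on the vertices of the input. -/
structure RandQueryAlg (n : ℕ) (Ω : Type*) [MeasurableSpace Ω] where
  /-- the deterministic algorithm that is executed for the seed `ω` -/
  alg : Ω → QueryAlg n (WeightedGraph (Fin n))
  measurable_run : ∀ I : GraphOracle n, Measurable fun ω => (alg ω).run I
  measurable_numQueries : ∀ I : GraphOracle n, Measurable fun ω => (alg ω).numQueries I

/-- The inputs with `n` vertices, positive degrees, at least `m₁` and at most `m₂` edges. -/
def sparseInputs (n : ℕ) (m₁ m₂ : ℝ) : Set (GraphOracle n) :=
  {I | (∀ v, 0 < I.deg v) ∧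
    m₁ ≤ (I.graph.edgeSet.ncard : ℝ) ∧ (I.graph.edgeSet.ncard : ℝ) ≤ m₂}

/-! Every query reveals at most one hidden bit of the input, so after few queries most bits are
unseen, and changing unseen bits does not change the output. One output then has to serve two
inputs. If, on some vertex set, the lower bound for one input exceeds the upper bound for the other,
the output violates one of the two requirements. Averaging over seeds and inputs, with `p = 3/4`,
turns this into a bound on the expected number of queries. Three families of inputs cover all
parameters; write `θ = 1 - ε₁`.

If `δ ≤ ε ^ 2` and `δ` is small (`le_queries_of_sheets`), take pairs of disjoint complete bipartite
graphs with sides of size `d ≈ θ / (4δ)`. Crossing two parallel edges of a pair makes an empty cut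
with `2d` vertices nonempty, which an additive error `2dδ < 1 - ε` cannot hide. All of the order of
`n / δ` possible places of the crossing have to be searched.

If `ε ^ 2 ≤ δ` and `ε` is small (`le_queries_of_lift`), take random two-fold covers of a complete
bipartite graph, with `s ≈ 1 / (4096 ε ^ 2)` bits for each left vertex. If every left vertex chooses
its sheet by the majority of its bits, the cut gains order `√s` on a base of `s` per left vertex, a
relative gain that exceeds the error `ε`. Let `z` be fresh bits, independent of the input `x`, and
use the cut that is optimal for `z`. For `x` it typically has no gain, and the upper bound applies
because the set is fixed in advance. The input with the seen bits of `x` and the unseen bits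
replaced by those of `z` has the same output and is again uniform (`sum_mergeOn`); its cut has the
gain (`card_no_gain_le`), and the lower bound applies because it holds for all sets at once. Each
bit governs `b` cloned right vertices, which makes the cuts so large that `δ|U|` does not matter.

In the remaining cases `ε` and `δ` are bounded below in terms of `θ`, so only order `n` queries are
needed. They come from finding the vertex of large degree in each of about `n / 2` pairs
(`le_queries_of_hubs`). -/

/-! ### Query algorithms against hidden bits -/

/-- A family of inputs indexed by bit vectors, in which every single query reveals at most one
bit, and which one it reveals does not depend on the input. -/
structure SwitchFamily (n : ℕ) (B : Type*) where
  inst : (B → Bool) → GraphOracle n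
  degTouch : Fin n → Option B
  edgeTouch : Fin n → ℕ → Option B
  vert_eq : ∀ x y, (inst x).vert = (inst y).vert
  deg_eq : ∀ x y v, (∀ t ∈ degTouch v, x t = y t) → (inst x).deg v = (inst y).deg v
  edge_eq : ∀ x y v i, (∀ t ∈ edgeTouch v i, x t = y t) →
    (inst x).edgeAnswer v i = (inst y).edgeAnswer v i

theorem Option.card_toFinset_le_one {B : Type*} (o : Option B) : o.toFinset.card ≤ 1 := by
  cases o <;> simp

namespace SwitchFamily

variable {n : ℕ} {B : Type*} [DecidableEq B] {α : Type}

/-- The bits that the algorithm sees on the input with bit vector `x`. -/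
def touched (F : SwitchFamily n B) (x : B → Bool) : QueryAlg n α → Finset B
  | .output _ => ∅
  | .vertexQuery i next => F.touched x (next ((F.inst x).vert i))
  | .degreeQuery v next => (F.degTouch v).toFinset ∪ F.touched x (next ((F.inst x).deg v))
  | .edgeQuery v i next =>
      (F.edgeTouch v i).toFinset ∪ F.touched x (next ((F.inst x).edgeAnswer v i))

theorem card_touched_le (F : SwitchFamily n B) (x : B → Bool) (a : QueryAlg n α) :
    (F.touched x a).card ≤ a.numQueries (F.inst x) := by
  induction a with
  | output a => simp [touched]
  | vertexQuery i next ih =>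
    simp only [touched, QueryAlg.numQueries]
    exact (ih _).trans (Nat.le_succ _)
  | degreeQuery v next ih =>
    simp only [touched, QueryAlg.numQueries]
    have := Option.card_toFinset_le_one (F.degTouch v)
    have := ih ((F.inst x).deg v)
    refine (Finset.card_union_le _ _).trans (by omega)
  | edgeQuery v i next ih =>
    simp only [touched, QueryAlg.numQueries]
    have := Option.card_toFinset_le_one (F.edgeTouch v i)
    have := ih ((F.inst x).edgeAnswer v i)
    refine (Finset.card_union_le _ _).trans (by omega)

/-- Inputs that agree on the bits seen on one of them cannot be distinguished. -/
theorem run_eq_and_touched_eq (F : SwitchFamily n B) (x y : B → Bool) (a : QueryAlg n α)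
    (h : ∀ t ∈ F.touched x a, x t = y t) :
    a.run (F.inst x) = a.run (F.inst y) ∧ F.touched x a = F.touched y a := by
  induction a with
  | output a => simp [touched, QueryAlg.run]
  | vertexQuery i next ih =>
    simp only [touched, QueryAlg.run] at h ⊢
    rw [F.vert_eq y x]
    exact ih _ h
  | degreeQuery v next ih =>
    simp only [touched, QueryAlg.run, Finset.mem_union, Option.mem_toFinset] at h ⊢
    rw [← F.deg_eq x y v fun t ht => h t (Or.inl ht)]
    have := ih _ fun t ht => h t (Or.inr ht)
    exact ⟨this.1, by rw [this.2]⟩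
  | edgeQuery v i next ih =>
    simp only [touched, QueryAlg.run, Finset.mem_union, Option.mem_toFinset] at h ⊢
    rw [← F.edge_eq x y v i fun t ht => h t (Or.inl ht)]
    have := ih _ fun t ht => h t (Or.inr ht)
    exact ⟨this.1, by rw [this.2]⟩

end SwitchFamily

/-- The bit vector that equals `x` on `T` and `z` elsewhere. -/
def mergeOn {B : Type*} [DecidableEq B] (T : Finset B) (x z : B → Bool) : B → Bool :=
  fun t => if t ∈ T then x t else z t

/-- Replacing the bits outside a set `T x` that is determined by the bits in it by independent
uniform bits does not change the uniform distribution. -/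
theorem sum_mergeOn {B : Type*} [DecidableEq B] [Fintype B] (T : (B → Bool) → Finset B)
    (hT : ∀ x y, (∀ t ∈ T x, x t = y t) → T x = T y) (f : (B → Bool) → ℝ) :
    ∑ q : (B → Bool) × (B → Bool), f (mergeOn (T q.1) q.1 q.2) =
      ∑ q : (B → Bool) × (B → Bool), f q.1 := by
  have key : ∀ x z, T (mergeOn (T x) x z) = T x := fun x z =>
    (hT x _ fun t ht => by simp [mergeOn, ht]).symm
  -- The bits outside `T x` are exchanged between `x` and `z`. By `key` the set is the same after
  -- the exchange, so exchanging twice is the identity and the map is a bijection on pairs.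
  have hinv : Function.Involutive fun q : (B → Bool) × (B → Bool) =>
      (mergeOn (T q.1) q.1 q.2, mergeOn (T q.1) q.2 q.1) := by
    rintro ⟨x, z⟩
    simp only [key]
    ext t <;> by_cases ht : t ∈ T x <;> simp [mergeOn, ht]
  exact Equiv.sum_comp hinv.toPerm fun q => f q.1

/-! ### Measurability and averaging of events -/

theorem measurable_cut {n : ℕ} (U : Finset (Fin n)) :
    Measurable fun w : WeightedGraph (Fin n) => w.cut U := by
  unfold WeightedGraph.cut
  fun_prop

theorem integrable_natCast_of_lintegral_lt {Ω : Type*} [MeasurableSpace Ω] {μ : Measure Ω}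
    {f : Ω → ℕ} (hf : Measurable f) {Q : ℝ}
    (h : ∫⁻ ω, (f ω : ENNReal) ∂μ < ENNReal.ofReal Q) :
    Integrable (fun ω => (f ω : ℝ)) μ ∧ ∫ ω, (f ω : ℝ) ∂μ ≤ Q := by
  have hmeas : Measurable fun ω => (f ω : ℝ) := measurable_from_nat.comp hf
  have e : ∀ ω, ENNReal.ofReal (f ω : ℝ) = (f ω : ENNReal) := fun ω => ENNReal.ofReal_natCast _
  have hQ : 0 < Q := by
    by_contra hQ
    simp [ENNReal.ofReal_of_nonpos (not_lt.1 hQ)] at h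
  constructor
  · refine ⟨hmeas.aestronglyMeasurable, ?_⟩
    rw [hasFiniteIntegral_iff_ofReal (Filter.Eventually.of_forall fun ω => by simp)]
    simp only [e]
    exact h.trans ENNReal.ofReal_lt_top
  · rw [integral_eq_lintegral_of_nonneg_ae (Filter.Eventually.of_forall fun ω => by simp)
      hmeas.aestronglyMeasurable]
    simp only [e]
    exact ENNReal.toReal_le_of_le_ofReal hQ.le h.le

/-- If every event of a finite family has probability at least `p`, then a pointwise bound on the
number of events that occur bounds `p`. -/
theorem le_of_sum_indicator_le {Ω : Type*} [MeasurableSpace Ω] (μ : Measure Ω)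
    [IsProbabilityMeasure μ] {J X : Type*} [Fintype J] [Fintype X] (S : J → Set Ω)
    (hS : ∀ j, MeasurableSet (S j)) {p : ℝ} (hp : ∀ j, p ≤ μ.real (S j))
    (q : X → Ω → ℝ) (hq : ∀ i, Integrable (q i) μ) {Q : ℝ} (hQ : ∀ i, ∫ ω, q i ω ∂μ ≤ Q)
    {a b : ℝ} (hb : 0 ≤ b)
    (h : ∀ ω, ∑ j, (S j).indicator (fun _ => (1 : ℝ)) ω ≤ a + b * ∑ i, q i ω) :
    Fintype.card J * p ≤ a + b * (Fintype.card X * Q) := by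
  have hint : ∀ j, Integrable ((S j).indicator fun _ => (1 : ℝ)) μ := fun j =>
    (integrable_const _).indicator (hS j)
  calc Fintype.card J * p = ∑ j : J, p := by simp
    _ ≤ ∑ j, μ.real (S j) := Finset.sum_le_sum fun j _ => hp j
    _ = ∑ j, ∫ ω, (S j).indicator (fun _ => (1 : ℝ)) ω ∂μ := by
        refine Finset.sum_congr rfl fun j _ => ?_
        rw [integral_indicator_const _ (hS j)]; simp
    _ = ∫ ω, ∑ j, (S j).indicator (fun _ => (1 : ℝ)) ω ∂μ :=
        (integral_finsetSum _ fun j _ => hint j).symm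
    _ ≤ ∫ ω, (a + b * ∑ i, q i ω) ∂μ := by
        refine integral_mono (integrable_finsetSum _ fun j _ => hint j) ?_ h
        exact (integrable_const _).add ((integrable_finsetSum _ fun i _ => hq i).const_mul _)
    _ = a + b * ∑ i, ∫ ω, q i ω ∂μ := by
        rw [integral_add (integrable_const _)
          ((integrable_finsetSum _ fun i _ => hq i).const_mul _), integral_const_mul,
          integral_finsetSum _ fun i _ => hq i]
        simp
    _ ≤ a + b * (Fintype.card X * Q) := by
        have : ∑ i, ∫ ω, q i ω ∂μ ≤ Fintype.card X * Q := by
          refine (Finset.sum_le_sum fun i _ => hQ i).trans ?_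
          simp
        gcongr

section events

variable {n : ℕ} {Ω : Type*} [MeasurableSpace Ω]

/-- The event that the output on `I` satisfies the lower bounds of a cut sparsifier. -/
def lowerEvent (A : RandQueryAlg n Ω) (ε : ℝ) (I : GraphOracle n) : Set Ω :=
  {ω | ∀ U : Finset (Fin n),
    (1 - ε) * (WeightedGraph.ofSimpleGraph I.graph).cut U ≤ ((A.alg ω).run I).cut U}

/-- The event that the output on `I` satisfies the upper bound of a cut sparsifier for `U`. -/
def upperEvent (A : RandQueryAlg n Ω) (ε δ : ℝ) (I : GraphOracle n) (U : Finset (Fin n)) :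
    Set Ω :=
  {ω | ((A.alg ω).run I).cut U ≤
    (1 + ε) * (WeightedGraph.ofSimpleGraph I.graph).cut U + δ * (U.card : ℝ)}

theorem measurableSet_lowerEvent (A : RandQueryAlg n Ω) (ε : ℝ) (I : GraphOracle n) :
    MeasurableSet (lowerEvent A ε I) := by
  unfold lowerEvent
  rw [Set.ofPred_forall]
  exact MeasurableSet.iInter fun U => measurableSet_le measurable_const
    ((measurable_cut U).comp (A.measurable_run I))

theorem measurableSet_upperEvent (A : RandQueryAlg n Ω) (ε δ : ℝ) (I : GraphOracle n)
    (U : Finset (Fin n)) : MeasurableSet (upperEvent A ε δ I U) :=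
  measurableSet_le ((measurable_cut U).comp (A.measurable_run I)) measurable_const

end events

theorem indicator_one_le_one {Ω : Type*} (S : Set Ω) (ω : Ω) :
    S.indicator (fun _ => (1 : ℝ)) ω ≤ 1 :=
  Set.indicator_le_self' (fun _ _ => zero_le_one) ω

/-- Two events that exclude each other at `ω`. -/
theorem indicator_add_indicator_le_one {Ω : Type*} {S S' : Set Ω} {ω : Ω}
    (h : ω ∈ S → ω ∉ S') :
    S.indicator (fun _ => (1 : ℝ)) ω + S'.indicator (fun _ => (1 : ℝ)) ω ≤ 1 := by
  by_cases hl : ω ∈ S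
  · rw [Set.indicator_of_notMem (h hl)]
    linarith [indicator_one_le_one S ω]
  · rw [Set.indicator_of_notMem hl]
    linarith [indicator_one_le_one S' ω]

/-! ### Two criteria that force many queries -/

namespace SwitchFamily

variable {n : ℕ} {B : Type*} [DecidableEq B] [Fintype B] {Ω : Type*} [MeasurableSpace Ω]

/-- The bit vector whose only `true` is at `t`. -/
def single (t : B) : B → Bool := fun u => decide (u = t)

/-- If every single bit flip of the zero input violates the sparsifier condition for the zero
input, then the bits have to be searched. -/
theorem le_queries_of_single_gap (F : SwitchFamily n B) (μ : Measure Ω) [IsProbabilityMeasure μ]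
    (A : RandQueryAlg n Ω) {p ε δ Q : ℝ}
    (hsp : ∀ x, IsProbCutSparsifier p ε δ (F.inst x).graph μ fun ω => (A.alg ω).run (F.inst x))
    (hQ : ∫⁻ ω, ((A.alg ω).numQueries (F.inst fun _ => false) : ENNReal) ∂μ < ENNReal.ofReal Q)
    (U : B → Finset (Fin n))
    (hgap : ∀ t, (1 + ε) * (WeightedGraph.ofSimpleGraph (F.inst fun _ => false).graph).cut (U t) +
        δ * ((U t).card : ℝ) <
      (1 - ε) * (WeightedGraph.ofSimpleGraph (F.inst (single t)).graph).cut (U t)) :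
    (2 * p - 1) * Fintype.card B ≤ Q := by
  obtain ⟨hint, hle⟩ := integrable_natCast_of_lintegral_lt (A.measurable_numQueries _) hQ
  let S : B ⊕ B → Set Ω := Sum.elim (fun t => lowerEvent A ε (F.inst (single t)))
    (fun t => upperEvent A ε δ (F.inst fun _ => false) (U t))
  -- For a fixed seed, each unseen bit allows only one of its two events; a seen bit may allow both.
  -- Only the run on the zero input is charged, hence the index type `Unit`.
  have hpt : ∀ ω, ∑ j, (S j).indicator (fun _ => (1 : ℝ)) ω ≤ Fintype.card B +
      1 * ∑ _i : Unit, ((A.alg ω).numQueries (F.inst fun _ => false) : ℝ) := by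
    intro ω
    have hone : ∀ t, (lowerEvent A ε (F.inst (single t))).indicator (fun _ => (1 : ℝ)) ω +
        (upperEvent A ε δ (F.inst fun _ => false) (U t)).indicator (fun _ => (1 : ℝ)) ω ≤
        1 + if t ∈ F.touched (fun _ => false) (A.alg ω) then (1 : ℝ) else 0 := by
      intro t
      by_cases ht : t ∈ F.touched (fun _ => false) (A.alg ω)
      · simp only [ht, if_true]
        linarith [indicator_one_le_one (lowerEvent A ε (F.inst (single t))) ω,
          indicator_one_le_one (upperEvent A ε δ (F.inst fun _ => false) (U t)) ω]
      · simp only [ht, if_false, add_zero]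
        have hrun := (F.run_eq_and_touched_eq (fun _ => false) (single t) (A.alg ω) fun u hu => by
          have : u ≠ t := fun h => ht (h ▸ hu)
          simp [single, this]).1
        refine indicator_add_indicator_le_one fun hl hu => ?_
        have a1 := hl (U t)
        rw [← hrun] at a1
        have a2 : ((A.alg ω).run _).cut (U t) ≤ _ := hu
        linarith [hgap t]
    have hcard : ((F.touched (fun _ => false) (A.alg ω)).card : ℝ) ≤
        ((A.alg ω).numQueries (F.inst fun _ => false) : ℝ) := by
      exact_mod_cast F.card_touched_le _ _
    simp only [S, Fintype.sum_sum_type, Sum.elim_inl, Sum.elim_inr]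
    rw [← Finset.sum_add_distrib]
    refine (Finset.sum_le_sum fun t _ => hone t).trans ?_
    rw [Finset.sum_add_distrib]
    simpa using hcard
  have := le_of_sum_indicator_le μ S
    (by rintro (t | t); exacts [measurableSet_lowerEvent .., measurableSet_upperEvent ..])
    (p := p) (by rintro (t | t); exacts [(hsp _).1, (hsp _).2 _])
    (fun (_ : Unit) ω => ((A.alg ω).numQueries (F.inst fun _ => false) : ℝ))
    (fun _ => hint) (fun _ => hle) zero_le_one hpt
  simp only [Fintype.card_sum, Fintype.card_unit] at this
  push_cast at this
  linarith

/-- If the cut `U z` of the input that is resampled from `z` outside a small set typically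
violates the sparsifier condition for the original input, then many bits have to be seen. -/
theorem le_queries_of_resample_gap (F : SwitchFamily n B) (μ : Measure Ω) [IsProbabilityMeasure μ]
    (A : RandQueryAlg n Ω) {p ε δ Q : ℝ}
    (hsp : ∀ x, IsProbCutSparsifier p ε δ (F.inst x).graph μ fun ω => (A.alg ω).run (F.inst x))
    (hQ : ∀ x, ∫⁻ ω, ((A.alg ω).numQueries (F.inst x) : ENNReal) ∂μ < ENNReal.ofReal Q)
    (U : (B → Bool) → Finset (Fin n)) {a b : ℝ} (hb : 0 ≤ b)
    (hgap : ∀ (x : B → Bool) (T : Finset B), ((Finset.univ.filter fun z : B → Bool =>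
        (1 - ε) * (WeightedGraph.ofSimpleGraph (F.inst (mergeOn T x z)).graph).cut (U z) ≤
        (1 + ε) * (WeightedGraph.ofSimpleGraph (F.inst x).graph).cut (U z) +
          δ * ((U z).card : ℝ)).card : ℝ) ≤ (a + b * T.card) * Fintype.card (B → Bool)) :
    2 * p ≤ 1 + a + b * Q := by
  have hI := fun x => integrable_natCast_of_lintegral_lt (A.measurable_numQueries _) (hQ x)
  let Y := B → Bool
  let S : (Y × Y) ⊕ (Y × Y) → Set Ω := Sum.elim (fun q => lowerEvent A ε (F.inst q.1))
    (fun q => upperEvent A ε δ (F.inst q.1) (U q.2))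
  set M : ℝ := (Fintype.card Y : ℝ) with hM
  have hM0 : 0 < M := by
    rw [hM]; exact_mod_cast Fintype.card_pos
  -- With the seed fixed the algorithm is deterministic, so the set of seen bits is a function of
  -- `x` and the counting is over pairs `(x, z)` only.
  have hpt : ∀ ω, ∑ j, (S j).indicator (fun _ => (1 : ℝ)) ω ≤ (1 + a) * M ^ 2 +
      (b * M) * ∑ x : Y, ((A.alg ω).numQueries (F.inst x) : ℝ) := by
    intro ω
    let T : Y → Finset B := fun x => F.touched x (A.alg ω)
    have hT : ∀ x y, (∀ t ∈ T x, x t = y t) → T x = T y := fun x y h =>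
      (F.run_eq_and_touched_eq x y (A.alg ω) h).2
    have hone : ∀ q : Y × Y, (lowerEvent A ε (F.inst (mergeOn (T q.1) q.1 q.2))).indicator
          (fun _ => (1 : ℝ)) ω +
        (upperEvent A ε δ (F.inst q.1) (U q.2)).indicator (fun _ => (1 : ℝ)) ω ≤
        1 + if (1 - ε) * (WeightedGraph.ofSimpleGraph
            (F.inst (mergeOn (T q.1) q.1 q.2)).graph).cut (U q.2) ≤
          (1 + ε) * (WeightedGraph.ofSimpleGraph (F.inst q.1).graph).cut (U q.2) +
          δ * ((U q.2).card : ℝ) then (1 : ℝ) else 0 := by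
      rintro ⟨x, z⟩
      simp only
      split_ifs with hP
      · linarith [indicator_one_le_one (lowerEvent A ε (F.inst (mergeOn (T x) x z))) ω,
          indicator_one_le_one (upperEvent A ε δ (F.inst x) (U z)) ω]
      · have hrun := (F.run_eq_and_touched_eq x (mergeOn (T x) x z) (A.alg ω) fun t ht => by
          have : t ∈ T x := ht
          simp [mergeOn, this]).1
        rw [add_zero]
        refine indicator_add_indicator_le_one fun hl hu => ?_
        have a1 := hl (U z)
        rw [← hrun] at a1
        have a2 : ((A.alg ω).run _).cut (U z) ≤ _ := hu
        exact hP (a1.trans a2)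
    simp only [S, Fintype.sum_sum_type, Sum.elim_inl, Sum.elim_inr]
    -- The lower event of the input `x` is replaced by that of the resampled input, so that it can
    -- be paired with the upper event of `x` for the same output.
    rw [← sum_mergeOn T hT fun x => (lowerEvent A ε (F.inst x)).indicator (fun _ => (1 : ℝ)) ω,
      ← Finset.sum_add_distrib]
    refine (Finset.sum_le_sum fun q _ => hone q).trans ?_
    rw [Finset.sum_add_distrib, Fintype.sum_prod_type (fun q : Y × Y => ite _ _ _)]
    have hrow : ∀ x : Y, (∑ z : Y, if (1 - ε) * (WeightedGraph.ofSimpleGraph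
            (F.inst (mergeOn (T x) x z)).graph).cut (U z) ≤
          (1 + ε) * (WeightedGraph.ofSimpleGraph (F.inst x).graph).cut (U z) +
          δ * ((U z).card : ℝ) then (1 : ℝ) else 0) ≤
          (a + b * ((A.alg ω).numQueries (F.inst x) : ℝ)) * M := by
      intro x
      rw [Finset.sum_boole]
      refine (hgap x (T x)).trans ?_
      have : ((T x).card : ℝ) ≤ ((A.alg ω).numQueries (F.inst x) : ℝ) := by
        exact_mod_cast F.card_touched_le _ _
      gcongr
    have e1 : ∑ q : Y × Y, (1 : ℝ) = M ^ 2 := by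
      simp only [Finset.sum_const, Finset.card_univ, Fintype.card_prod, nsmul_eq_mul, mul_one,
        Nat.cast_mul, hM, sq]
    rw [e1]
    calc _ ≤ M ^ 2 + ∑ x : Y, (a + b * ((A.alg ω).numQueries (F.inst x) : ℝ)) * M := by
            gcongr with x _; exact hrow x
      _ = _ := by
        rw [← Finset.sum_mul, Finset.sum_add_distrib, ← Finset.mul_sum]
        simp only [Finset.sum_const, Finset.card_univ, nsmul_eq_mul, ← hM]
        ring
  have := le_of_sum_indicator_le μ S
    (by rintro (t | t); exacts [measurableSet_lowerEvent .., measurableSet_upperEvent ..])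
    (p := p) (by rintro (t | t); exacts [(hsp _).1, (hsp _).2 _])
    (fun (x : Y) ω => ((A.alg ω).numQueries (F.inst x) : ℝ))
    (fun x => (hI x).1) (fun x => (hI x).2) (by positivity) hpt
  rw [Fintype.card_sum, Fintype.card_prod] at this
  push_cast at this
  rw [← hM] at this
  have h3 : M ^ 2 * (2 * p) ≤ M ^ 2 * (1 + a + b * Q) := by nlinarith
  exact le_of_mul_le_mul_left h3 (by positivity)

end SwitchFamily

/-! ### Sums of independent signs -/

/-- The sign encoded by a bit. -/
def bitSign (b : Bool) : ℝ := if b then -1 else 1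

theorem bitSign_sq (b : Bool) : bitSign b ^ 2 = 1 := by cases b <;> simp [bitSign]

theorem bitSign_not (b : Bool) : bitSign (!b) = -bitSign b := by cases b <;> simp [bitSign]

theorem abs_bitSign (b : Bool) : |bitSign b| = 1 := by cases b <;> simp [bitSign]

/-! ### Second moments on product spaces -/

section independence

variable {ι Y : Type*} [Fintype ι] [DecidableEq ι] [Fintype Y]

theorem sum_pi_eq_sum_split (i : ι) (f : (ι → Y) → ℝ) :
    ∑ z, f z = ∑ w : {j // j ≠ i} → Y, ∑ y, f ((Equiv.funSplitAt i Y).symm (y, w)) := by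
  rw [← Equiv.sum_comp (Equiv.funSplitAt i Y).symm f, Fintype.sum_prod_type_right]

omit [Fintype ι] [Fintype Y] in
theorem funSplitAt_symm_self (i : ι) (y : Y) (w : {j // j ≠ i} → Y) :
    (Equiv.funSplitAt i Y).symm (y, w) i = y := by
  simp [Equiv.funSplitAt, Equiv.piSplitAt]

omit [Fintype ι] [Fintype Y] in
theorem funSplitAt_symm_ne {i j : ι} (h : j ≠ i) (y : Y) (w : {j // j ≠ i} → Y) :
    (Equiv.funSplitAt i Y).symm (y, w) j = w ⟨j, h⟩ := by
  simp [Equiv.funSplitAt, Equiv.piSplitAt, h]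

/-- The average of a function of one coordinate. -/
theorem card_mul_sum_apply (i : ι) (f : Y → ℝ) :
    (Fintype.card Y : ℝ) * ∑ z : ι → Y, f (z i) = Fintype.card (ι → Y) * ∑ y, f y := by
  have hc : Fintype.card (ι → Y) = Fintype.card Y * Fintype.card ({j // j ≠ i} → Y) := by
    rw [Fintype.card_congr (Equiv.funSplitAt i Y), Fintype.card_prod]
  rw [sum_pi_eq_sum_split i, hc]
  simp only [funSplitAt_symm_self, Finset.sum_const, Finset.card_univ, nsmul_eq_mul]
  push_cast
  ring

/-- Centred functions of different coordinates are orthogonal. -/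
theorem sum_mul_apply_eq_zero {i j : ι} (h : j ≠ i) {f : Y → ℝ} (hf : ∑ y, f y = 0)
    (g : Y → ℝ) : ∑ z : ι → Y, f (z i) * g (z j) = 0 := by
  rw [sum_pi_eq_sum_split i]
  simp only [funSplitAt_symm_self, funSplitAt_symm_ne h, ← Finset.sum_mul, hf, zero_mul,
    Finset.sum_const_zero]

/-- After expanding the square, the mixed terms vanish because the summands are centred functions of
different coordinates. Multiplying by the number of values of one coordinate avoids dividing to form
averages. -/
theorem card_mul_sum_sq (f : ι → Y → ℝ) (hf : ∀ i, ∑ y, f i y = 0) :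
    (Fintype.card Y : ℝ) * ∑ z : ι → Y, (∑ i, f i (z i)) ^ 2 =
      Fintype.card (ι → Y) * ∑ i, ∑ y, f i y ^ 2 := by
  have : ∀ i, ∑ z : ι → Y, ∑ j, f i (z i) * f j (z j) = ∑ z : ι → Y, f i (z i) ^ 2 := by
    intro i
    rw [Finset.sum_comm, Finset.sum_eq_single i]
    · simp [sq]
    · intro j _ hj
      exact sum_mul_apply_eq_zero hj (hf i) _
    · simp
  simp only [sq (∑ i, _), Finset.sum_mul_sum]
  rw [Finset.sum_comm]
  simp only [this]
  rw [Finset.mul_sum, Finset.mul_sum]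
  exact Finset.sum_congr rfl fun i _ => card_mul_sum_apply i fun y => f i y ^ 2

/-- Second moment bound for sums of independent centred random variables. -/
theorem sum_sq_le (f : ι → Y → ℝ) (hf : ∀ i, ∑ y, f i y = 0) (c : ι → ℝ)
    (hc : ∀ i, ∑ y, f i y ^ 2 ≤ Fintype.card Y * c i) [Nonempty Y] :
    ∑ z : ι → Y, (∑ i, f i (z i)) ^ 2 ≤ Fintype.card (ι → Y) * ∑ i, c i := by
  have hY : (0 : ℝ) < Fintype.card Y := by exact_mod_cast Fintype.card_pos
  refine le_of_mul_le_mul_left ?_ hY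
  rw [card_mul_sum_sq f hf]
  calc _ ≤ (Fintype.card (ι → Y) : ℝ) * ∑ i, Fintype.card Y * c i := by
        gcongr with i _; exact hc i
    _ = _ := by rw [← Finset.mul_sum]; ring

/-- Markov's inequality for the square of a function on a finite type. -/
theorem card_filter_mul_sq_le {Z : Type*} [Fintype Z] (f : Z → ℝ) {r : ℝ} (hr : 0 ≤ r) {S : ℝ}
    (hS : ∑ z, f z ^ 2 ≤ S) :
    ((Finset.univ.filter fun z => r ≤ |f z|).card : ℝ) * r ^ 2 ≤ S := by
  refine le_trans ?_ hS
  rw [← nsmul_eq_mul, ← Finset.sum_const]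
  refine (Finset.sum_le_sum fun z hz => ?_).trans
    (Finset.sum_le_sum_of_subset_of_nonneg (Finset.filter_subset (fun z => r ≤ |f z|) _)
      fun z _ _ => sq_nonneg (f z))
  rw [← sq_abs (f z)]
  exact pow_le_pow_left₀ hr (Finset.mem_filter.1 hz).2 2

end independence

/-! ### Moments of sums of signs -/

section signs

variable {τ : Type*} [Fintype τ] [DecidableEq τ]

/-- The second moment of a sum of independent signs. -/
theorem sum_sq_bitSign (S : Finset τ) :
    ∑ y : τ → Bool, (∑ t ∈ S, bitSign (y t)) ^ 2 = Fintype.card (τ → Bool) * (S.card : ℝ) := by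
  have h := card_mul_sum_sq (ι := τ) (Y := Bool) (fun t b => if t ∈ S then bitSign b else 0)
    fun t => by by_cases ht : t ∈ S <;> simp [ht, bitSign]
  have e : ∀ t, ∑ b : Bool, (if t ∈ S then bitSign b else 0) ^ 2 =
      if t ∈ S then (2 : ℝ) else 0 := fun t => by
    by_cases ht : t ∈ S <;> simp [ht, bitSign]
  simp only [e, Finset.sum_ite_mem, Finset.univ_inter, Finset.sum_const, nsmul_eq_mul,
    Fintype.card_bool] at h
  push_cast at h ⊢
  linarith

/-- Flipping the bit `t` is an involution that fixes `g` and negates the sign, so the sum equals its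
own negative. -/
theorem sum_mul_bitSign_eq_zero {t : τ} (g : (τ → Bool) → ℝ)
    (hg : ∀ y, g (Function.update y t (!y t)) = g y) :
    ∑ y : τ → Bool, g y * bitSign (y t) = 0 := by
  have hinv : Function.Involutive fun y : τ → Bool => Function.update y t (!y t) := by
    intro y; simp
  have h := Equiv.sum_comp hinv.toPerm fun y => g y * bitSign (y t)
  simp only [Function.Involutive.coe_toPerm, hg, Function.update_self, bitSign_not, mul_neg,
    Finset.sum_neg_distrib] at h
  linarith

/-- The fourth moment of a sum of independent signs. -/
theorem sum_pow_four_bitSign_le (S : Finset τ) :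
    ∑ y : τ → Bool, (∑ t ∈ S, bitSign (y t)) ^ 4 ≤
      3 * (S.card : ℝ) ^ 2 * Fintype.card (τ → Bool) := by
  induction S using Finset.induction_on with
  | empty => simp
  | insert t S ht ih =>
    have hA : ∀ y : τ → Bool, ∑ u ∈ S, bitSign (Function.update y t (!y t) u) =
        ∑ u ∈ S, bitSign (y u) := fun y => Finset.sum_congr rfl fun u hu => by
      rw [Function.update_of_ne (ne_of_mem_of_not_mem hu ht)]
    have h1 := sum_mul_bitSign_eq_zero (t := t)
      (fun y => 4 * (∑ u ∈ S, bitSign (y u)) ^ 3 + 4 * ∑ u ∈ S, bitSign (y u))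
      fun y => by simp only [hA]
    have h2 := sum_sq_bitSign S
    -- Binomial expansion with the square of the new sign replaced by `1`. The terms odd in the new
    -- sign are collected at the end, since they average to zero.
    have e : ∀ y : τ → Bool, (∑ u ∈ insert t S, bitSign (y u)) ^ 4 =
        (∑ u ∈ S, bitSign (y u)) ^ 4 + 6 * (∑ u ∈ S, bitSign (y u)) ^ 2 + 1 +
        (4 * (∑ u ∈ S, bitSign (y u)) ^ 3 + 4 * ∑ u ∈ S, bitSign (y u)) * bitSign (y t) := by
      intro y
      rw [Finset.sum_insert ht]
      have := bitSign_sq (y t)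
      generalize bitSign (y t) = b at this
      generalize ∑ u ∈ S, bitSign (y u) = a
      linear_combination (4 * a * b + 6 * a ^ 2 + b ^ 2 + 1) * this
    simp only [e]
    rw [Finset.sum_add_distrib, h1, Finset.sum_add_distrib, Finset.sum_add_distrib,
      ← Finset.mul_sum, h2, Finset.card_insert_of_notMem ht]
    simp only [Finset.sum_const, Finset.card_univ, nsmul_eq_mul, mul_one, add_zero]
    -- With `k` old signs, the induction step is `3k² + 6k + 1 ≤ 3(k + 1)²`.
    have hM : (0 : ℝ) ≤ Fintype.card (τ → Bool) := by positivity
    push_cast at *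
    nlinarith

/-- The sum of the signs of a row of bits. -/
def rowSum (y : τ → Bool) : ℝ := ∑ t, bitSign (y t)

omit [DecidableEq τ] in
theorem rowSum_not (y : τ → Bool) : rowSum (fun t => !y t) = -rowSum y := by
  simp [rowSum, bitSign_not]

/-- An odd function of the bits has mean zero. -/
theorem sum_eq_zero_of_odd (f : (τ → Bool) → ℝ) (hf : ∀ y, f (fun t => !y t) = -f y) :
    ∑ y, f y = 0 := by
  have hinv : Function.Involutive fun (y : τ → Bool) t => !y t := fun y => by simp
  have h := Equiv.sum_comp hinv.toPerm f
  simp only [Function.Involutive.coe_toPerm, hf, Finset.sum_neg_distrib] at h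
  linarith

/-- A form of Khinchine's inequality. -/
theorem le_sum_abs_rowSum [Nonempty τ] :
    9 / 16 * √(Fintype.card τ) * Fintype.card (τ → Bool) ≤ ∑ y : τ → Bool, |rowSum y| := by
  set s : ℝ := (Fintype.card τ : ℝ) with hs
  have hs0 : 0 < s := by rw [hs]; exact_mod_cast Fintype.card_pos
  have hq : 0 < √s := Real.sqrt_pos.2 hs0
  have hqq : √s ^ 2 = s := Real.sq_sqrt hs0.le
  have h2 := sum_sq_bitSign (Finset.univ : Finset τ)
  have h4 := sum_pow_four_bitSign_le (Finset.univ : Finset τ)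
  rw [Finset.card_univ, ← hs] at h2 h4
  -- A polynomial minorant of the absolute value, touching it at `2√s`. The second moment `s` and
  -- the fourth moment bound `3s²` then give `3/4 - 3/16 = 9/16`.
  have hpt : ∀ y : τ → Bool,
      3 / 4 / √s * rowSum y ^ 2 - 1 / 16 / √s ^ 3 * rowSum y ^ 4 ≤ |rowSum y| := by
    intro y
    have e2 : rowSum y ^ 2 = |rowSum y| ^ 2 := (sq_abs _).symm
    have e4 : rowSum y ^ 4 = |rowSum y| ^ 4 := by
      rw [show rowSum y ^ 4 = (rowSum y ^ 2) ^ 2 by ring, e2]; ring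
    rw [e2, e4]
    have ha := abs_nonneg (rowSum y)
    generalize |rowSum y| = a at ha
    obtain ⟨v, hv, rfl⟩ : ∃ v, 0 ≤ v ∧ a = v * √s := ⟨a / √s, by positivity, by field_simp⟩
    have : 3 / 4 / √s * (v * √s) ^ 2 - 1 / 16 / √s ^ 3 * (v * √s) ^ 4 =
        √s * (3 / 4 * v ^ 2 - 1 / 16 * v ^ 4) := by field_simp
    rw [this, mul_comm v]
    refine mul_le_mul_of_nonneg_left ?_ hq.le
    -- The difference of the two sides is `v (v - 2)² (v + 4) / 16`.
    nlinarith [mul_nonneg hv (mul_nonneg (sq_nonneg (v - 2)) (by linarith : 0 ≤ v + 4))]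
  have hsum := Finset.sum_le_sum fun y (_ : y ∈ Finset.univ) => hpt y
  rw [Finset.sum_sub_distrib, ← Finset.mul_sum, ← Finset.mul_sum] at hsum
  simp only [rowSum] at hsum ⊢
  rw [h2] at hsum
  refine le_trans ?_ hsum
  have hM : (0 : ℝ) ≤ Fintype.card (τ → Bool) := by positivity
  have : 1 / 16 / √s ^ 3 * ∑ y : τ → Bool, (∑ t, bitSign (y t)) ^ 4 ≤
      1 / 16 / √s ^ 3 * (3 * s ^ 2 * Fintype.card (τ → Bool)) := by gcongr
  refine le_trans (le_of_eq ?_) (sub_le_sub_left this _)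
  rw [← hqq]
  have : √(√s ^ 2) = √s := by rw [hqq]
  rw [this]
  field_simp
  ring

end signs

theorem Real.sign_mul_self_eq_abs (r : ℝ) : Real.sign r * r = |r| := by
  rcases lt_trichotomy r 0 with h | h | h
  · rw [Real.sign_of_neg h, abs_of_neg h]; ring
  · simp [h]
  · rw [Real.sign_of_pos h, abs_of_pos h]; ring

theorem Real.sign_sq_le_one (r : ℝ) : Real.sign r ^ 2 ≤ 1 := by
  rcases Real.sign_apply_eq r with h | h | h <;> simp [h]

/-! ### Concentration for many independent rows -/

section rows

variable {ι τ : Type*} [Fintype ι] [DecidableEq ι] [Fintype τ] [DecidableEq τ]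

omit [DecidableEq τ] in
theorem abs_sum_bitSign_le (S : Finset τ) (y : τ → Bool) :
    |∑ t ∈ S, bitSign (y t)| ≤ Fintype.card τ := by
  refine (Finset.abs_sum_le_sum_abs _ _).trans ?_
  simp only [abs_bitSign, Finset.sum_const, nsmul_eq_mul, mul_one]
  exact_mod_cast Finset.card_le_univ S

/-- The signed sum of constants, with the signs of the row sums, is rarely large. -/
theorem card_large_signed_sum_le [Nonempty ι] [Nonempty τ] (q : ι → ℝ)
    (hq : ∀ i, |q i| ≤ Fintype.card τ)
    (hR : 16384 * (Fintype.card τ : ℝ) ≤ Fintype.card ι) :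
    ((Finset.univ.filter fun z : ι → τ → Bool =>
      Fintype.card ι * √(Fintype.card τ) / 32 ≤ |∑ i, Real.sign (rowSum (z i)) * q i|).card : ℝ) ≤
      1 / 16 * Fintype.card (ι → τ → Bool) := by
  -- The sign of a row sum is odd under flipping the whole row and `q i` is constant, so the
  -- summands are centred and independent.
  have h1 := sum_sq_le (fun (i : ι) (y : τ → Bool) => Real.sign (rowSum y) * q i)
    (fun i => sum_eq_zero_of_odd _ fun y => by rw [rowSum_not, Real.sign_neg]; ring)
    (fun _ => (Fintype.card τ : ℝ) ^ 2) fun i => by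
      calc ∑ y : τ → Bool, (Real.sign (rowSum y) * q i) ^ 2
          ≤ ∑ _y : τ → Bool, (Fintype.card τ : ℝ) ^ 2 := by
            refine Finset.sum_le_sum fun y _ => ?_
            rw [mul_pow, ← sq_abs (q i)]
            have := pow_le_pow_left₀ (abs_nonneg _) (hq i) 2
            nlinarith [Real.sign_sq_le_one (rowSum y), sq_nonneg |q i|]
        _ = _ := by simp
  have h2 := card_filter_mul_sq_le _ (r := Fintype.card ι * √(Fintype.card τ) / 32)
    (by positivity) h1
  have hs : (0 : ℝ) < Fintype.card τ := by exact_mod_cast Fintype.card_pos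
  have hr : (0 : ℝ) < Fintype.card ι := by exact_mod_cast Fintype.card_pos
  have hqq := Real.sq_sqrt hs.le
  simp only [Finset.sum_const, Finset.card_univ, nsmul_eq_mul] at h2
  rw [div_pow, mul_pow, hqq] at h2
  generalize (Fintype.card τ : ℝ) = s at *
  generalize (Fintype.card ι : ℝ) = R at *
  have hM : (0 : ℝ) ≤ Fintype.card (ι → τ → Bool) := by positivity
  generalize (Fintype.card (ι → τ → Bool) : ℝ) = M at *
  generalize (Finset.card _ : ℝ) = N at *
  -- Chebyshev: the second moment `R s²` against the squared threshold `R² s / 1024` leaves a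
  -- fraction `1024 s / R`, which is at most `1/16` as `R ≥ 16384 s`.
  have h3 : (R * s) * (N * R) ≤ (R * s) * (1 / 16 * M * R) := by
    have : N * R * (R * s) ≤ M * (R * s) * (1024 * s) := by nlinarith
    have h4 : M * (R * s) * (16384 * s) ≤ M * (R * s) * R := by gcongr
    nlinarith
  have h5 := le_of_mul_le_mul_left h3 (by positivity)
  exact le_of_mul_le_mul_right h5 hr

/-- The sum of the absolute row sums is rarely small. -/
theorem card_small_sum_abs_rowSum_le [Nonempty ι] [Nonempty τ]
    (hR : 16384 * (Fintype.card τ : ℝ) ≤ Fintype.card ι) :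
    ((Finset.univ.filter fun z : ι → τ → Bool =>
      ∑ i, |rowSum (z i)| < Fintype.card ι * √(Fintype.card τ) / 2).card : ℝ) ≤
      1 / 16 * Fintype.card (ι → τ → Bool) := by
  have hY : (0 : ℝ) < Fintype.card (τ → Bool) := by exact_mod_cast Fintype.card_pos
  have hs : (1 : ℝ) ≤ Fintype.card τ := by exact_mod_cast Fintype.card_pos
  have hr : (0 : ℝ) < Fintype.card ι := by exact_mod_cast Fintype.card_pos
  set m : ℝ := (∑ y : τ → Bool, |rowSum y|) / Fintype.card (τ → Bool) with hm
  have hmY : ∑ y : τ → Bool, |rowSum y| = m * Fintype.card (τ → Bool) := by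
    rw [hm]; field_simp
  have hm9 : 9 / 16 * √(Fintype.card τ) ≤ m := by
    rw [hm, le_div_iff₀ hY]; exact le_sum_abs_rowSum
  have h1 := sum_sq_le (fun (_ : ι) (y : τ → Bool) => |rowSum y| - m)
    (fun i => by
      rw [Finset.sum_sub_distrib, hmY]
      simp only [Finset.sum_const, Finset.card_univ, nsmul_eq_mul]; ring)
    (fun _ => (Fintype.card τ : ℝ)) fun i => by
      have h2 := sum_sq_bitSign (Finset.univ : Finset τ)
      rw [Finset.card_univ] at h2
      rw [← h2]
      have : ∀ y : τ → Bool, (|rowSum y| - m) ^ 2 =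
          (∑ t, bitSign (y t)) ^ 2 + (m ^ 2 - 2 * m * |rowSum y|) := fun y => by
        rw [sub_sq, sq_abs, rowSum]; ring
      simp only [this]
      rw [Finset.sum_add_distrib, Finset.sum_sub_distrib, ← Finset.mul_sum, hmY]
      simp only [Finset.sum_const, Finset.card_univ, nsmul_eq_mul]
      nlinarith [sq_nonneg m]
  have h2 := card_filter_mul_sq_le _ (r := Fintype.card ι * √(Fintype.card τ) / 16)
    (by positivity) h1
  -- The mean `m` is at least `9/16 √s`, so falling below `1/2 √s` per row is a deviation of at
  -- least `1/16 √s` per row.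
  have hsub : (Finset.univ.filter fun z : ι → τ → Bool =>
      ∑ i, |rowSum (z i)| < Fintype.card ι * √(Fintype.card τ) / 2) ⊆
      Finset.univ.filter fun z : ι → τ → Bool =>
        Fintype.card ι * √(Fintype.card τ) / 16 ≤ |∑ i, (|rowSum (z i)| - m)| := by
    intro z hz
    simp only [Finset.mem_filter, Finset.mem_univ, true_and] at hz ⊢
    rw [Finset.sum_sub_distrib]
    simp only [Finset.sum_const, Finset.card_univ, nsmul_eq_mul]
    refine le_abs.2 (Or.inr ?_)
    nlinarith
  have hcard : ((Finset.univ.filter fun z : ι → τ → Bool =>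
      ∑ i, |rowSum (z i)| < Fintype.card ι * √(Fintype.card τ) / 2).card : ℝ) ≤
      ((Finset.univ.filter fun z : ι → τ → Bool =>
        Fintype.card ι * √(Fintype.card τ) / 16 ≤ |∑ i, (|rowSum (z i)| - m)|).card : ℝ) := by
    exact_mod_cast Finset.card_le_card hsub
  refine hcard.trans ?_
  have hqq := Real.sq_sqrt (zero_le_one.trans hs)
  simp only [Finset.sum_const, Finset.card_univ, nsmul_eq_mul] at h2
  rw [div_pow, mul_pow, hqq] at h2
  clear hcard hsub h1 hmY hm hm9
  generalize (Finset.card _ : ℝ) = N at *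
  generalize (Fintype.card τ : ℝ) = s at *
  generalize (Fintype.card ι : ℝ) = R at *
  have hM : (0 : ℝ) ≤ Fintype.card (ι → τ → Bool) := by positivity
  generalize (Fintype.card (ι → τ → Bool) : ℝ) = M at *
  have h3 : (R * s) * (N * R) ≤ (R * s) * (1 / 16 * M * R) := by
    have h4 : M * (R * s) * 4096 ≤ M * (R * s) * R := by
      gcongr; linarith
    nlinarith
  have h5 := le_of_mul_le_mul_left h3 (by positivity)
  exact le_of_mul_le_mul_right h5 hr

/-- A signed sum over a small set of bits is rarely large. -/
theorem card_large_partial_sum_le [Nonempty ι] [Nonempty τ] (T : ι → Finset τ) :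
    ((Finset.univ.filter fun z : ι → τ → Bool =>
      Fintype.card ι * √(Fintype.card τ) / 32 ≤
        |∑ i, Real.sign (rowSum (z i)) * ∑ t ∈ T i, bitSign (z i t)|).card : ℝ) ≤
      1024 / (Fintype.card ι * Fintype.card τ) * (∑ i, ((T i).card : ℝ)) *
        Fintype.card (ι → τ → Bool) := by
  have hY : (0 : ℝ) < Fintype.card (τ → Bool) := by exact_mod_cast Fintype.card_pos
  have hs : (0 : ℝ) < Fintype.card τ := by exact_mod_cast Fintype.card_pos
  have hr : (0 : ℝ) < Fintype.card ι := by exact_mod_cast Fintype.card_pos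
  have hi : ∀ i, ∑ z : ι → τ → Bool, (∑ t ∈ T i, bitSign (z i t)) ^ 2 =
      Fintype.card (ι → τ → Bool) * ((T i).card : ℝ) := by
    intro i
    have := card_mul_sum_apply i fun y : τ → Bool => (∑ t ∈ T i, bitSign (y t)) ^ 2
    rw [sum_sq_bitSign] at this
    refine mul_left_cancel₀ hY.ne' ?_
    rw [this]; ring
  have h1 : ∑ z : ι → τ → Bool,
      (∑ i, Real.sign (rowSum (z i)) * ∑ t ∈ T i, bitSign (z i t)) ^ 2 ≤
      Fintype.card ι * (Fintype.card (ι → τ → Bool) * ∑ i, ((T i).card : ℝ)) := by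
    -- The sign depends on the very bits that it multiplies, so the summands need not be centred.
    -- Cauchy–Schwarz over the rows replaces orthogonality and removes the signs; the loss of a
    -- factor `R` is affordable.
    calc _ ≤ ∑ z : ι → τ → Bool, (Fintype.card ι : ℝ) *
          ∑ i, (∑ t ∈ T i, bitSign (z i t)) ^ 2 := by
          refine Finset.sum_le_sum fun z _ => ?_
          refine sq_sum_le_card_mul_sum_sq.trans ?_
          rw [Finset.card_univ]
          refine mul_le_mul_of_nonneg_left (Finset.sum_le_sum fun i _ => ?_) (by positivity)
          rw [mul_pow]
          exact mul_le_of_le_one_left (sq_nonneg _) (Real.sign_sq_le_one _)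
      _ = _ := by
          rw [← Finset.mul_sum, Finset.sum_comm]
          simp only [hi, Finset.mul_sum]
  have h2 := card_filter_mul_sq_le _ (r := Fintype.card ι * √(Fintype.card τ) / 32)
    (by positivity) h1
  have hqq := Real.sq_sqrt hs.le
  rw [div_pow, mul_pow, hqq] at h2
  generalize (Fintype.card τ : ℝ) = s at *
  generalize (Fintype.card ι : ℝ) = R at *
  generalize (Fintype.card (ι → τ → Bool) : ℝ) = M at *
  clear h1 hi
  generalize ∑ i, ((T i).card : ℝ) = L at *
  generalize (Finset.card _ : ℝ) = N at *
  rw [show 1024 / (R * s) * L * M = 1024 * L * M / (R * s) by ring, le_div_iff₀ (by positivity)]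
  refine le_of_mul_le_mul_left ?_ hr
  nlinarith

end rows

/-! ### The gain of the majority cut after resampling -/

section gain

variable {ι τ : Type*} [Fintype ι] [DecidableEq ι] [Fintype τ] [DecidableEq τ]

/-- The excess over half of the edges of the cut that is optimal for `z`, in the input `x`. -/
noncomputable def signedCut (z x : ι × τ → Bool) : ℝ :=
  ∑ i, Real.sign (rowSum fun t => z (i, t)) * ∑ t, bitSign (x (i, t))

omit [DecidableEq ι] [DecidableEq τ] in
theorem sum_card_fiber [DecidableEq ι] [DecidableEq τ] (T : Finset (ι × τ)) :
    ∑ i, ((Finset.univ.filter fun t => (i, t) ∈ T).card : ℝ) = T.card := by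
  have h : ∑ p : ι × τ, (if p ∈ T then (1 : ℝ) else 0) = T.card := by simp
  rw [← h, Fintype.sum_prod_type]
  simp only [Finset.sum_boole]

/-- If all bits came from `z`, every row would contribute the absolute value of its sum. The two
corrections exchange the bits of `z` in `T` for those of `x`; both are small for typical `z` when
`T` is small. -/
theorem signedCut_mergeOn (z x : ι × τ → Bool) (T : Finset (ι × τ)) :
    signedCut z (mergeOn T x z) = ∑ i, |rowSum fun t => z (i, t)| -
      ∑ i, Real.sign (rowSum fun t => z (i, t)) *
        ∑ t ∈ Finset.univ.filter fun t => (i, t) ∈ T, bitSign (z (i, t)) +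
      ∑ i, Real.sign (rowSum fun t => z (i, t)) *
        ∑ t ∈ Finset.univ.filter fun t => (i, t) ∈ T, bitSign (x (i, t)) := by
  rw [← Finset.sum_sub_distrib, ← Finset.sum_add_distrib]
  refine Finset.sum_congr rfl fun i _ => ?_
  rw [← Real.sign_mul_self_eq_abs, ← mul_sub, ← mul_add, Finset.sum_filter, Finset.sum_filter]
  congr 1
  rw [rowSum, ← Finset.sum_sub_distrib, ← Finset.sum_add_distrib]
  refine Finset.sum_congr rfl fun t _ => ?_
  by_cases h : (i, t) ∈ T <;> simp [mergeOn, h]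

/-- Resampling the bits outside a small set typically makes the cut that is optimal for the new
bits much larger than it was before. -/
theorem card_no_gain_le [Nonempty ι] [Nonempty τ]
    (hR : 16384 * (Fintype.card τ : ℝ) ≤ Fintype.card ι) {ε L : ℝ} (hε0 : 0 ≤ ε) (hε : ε ≤ 1 / 2)
    (hL : 2 * ε * (Fintype.card ι * Fintype.card τ) + L ≤
      Fintype.card ι * √(Fintype.card τ) / 8)
    (x : ι × τ → Bool) (T : Finset (ι × τ)) :
    ((Finset.univ.filter fun z : ι × τ → Bool =>
      (1 - ε) * (Fintype.card ι * Fintype.card τ + signedCut z (mergeOn T x z)) ≤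
      (1 + ε) * (Fintype.card ι * Fintype.card τ + signedCut z x) + L).card : ℝ) ≤
      (3 / 16 + 1024 / (Fintype.card ι * Fintype.card τ) * T.card) *
        Fintype.card (ι × τ → Bool) := by
  have hs : (0 : ℝ) < Fintype.card τ := by exact_mod_cast Fintype.card_pos
  have hr : (0 : ℝ) < Fintype.card ι := by exact_mod_cast Fintype.card_pos
  have hq : 0 < √(Fintype.card τ : ℝ) := Real.sqrt_pos.2 hs
  set r : ℝ := Fintype.card ι * √(Fintype.card τ) / 32 with hrdef
  let Tr : ι → Finset τ := fun i => Finset.univ.filter fun t => (i, t) ∈ T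
  have hA := card_small_sum_abs_rowSum_le (ι := ι) (τ := τ) hR
  have hB := card_large_partial_sum_le (ι := ι) (τ := τ) Tr
  have hD := card_large_signed_sum_le (fun i => ∑ t ∈ Tr i, bitSign (x (i, t)))
    (fun i => abs_sum_bitSign_le (Tr i) fun t => x (i, t)) hR
  have hE := card_large_signed_sum_le (fun i => ∑ t, bitSign (x (i, t)))
    (fun i => abs_sum_bitSign_le Finset.univ fun t => x (i, t)) hR
  rw [sum_card_fiber] at hB
  have hc : (Fintype.card (ι × τ → Bool) : ℝ) = Fintype.card (ι → τ → Bool) := by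
    rw [Fintype.card_congr (Equiv.curry ι τ Bool)]
  rw [hc]
  set FA := Finset.univ.filter fun z : ι → τ → Bool =>
      ∑ i, |rowSum (z i)| < Fintype.card ι * √(Fintype.card τ) / 2
  set FB := Finset.univ.filter fun z : ι → τ → Bool =>
      r ≤ |∑ i, Real.sign (rowSum (z i)) * ∑ t ∈ Tr i, bitSign (z i t)|
  set FD := Finset.univ.filter fun z : ι → τ → Bool =>
      r ≤ |∑ i, Real.sign (rowSum (z i)) * ∑ t ∈ Tr i, bitSign (x (i, t))|
  set FE := Finset.univ.filter fun z : ι → τ → Bool =>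
      r ≤ |∑ i, Real.sign (rowSum (z i)) * ∑ t, bitSign (x (i, t))|
  have hcard : (Finset.univ.filter fun z : ι × τ → Bool =>
      (1 - ε) * (Fintype.card ι * Fintype.card τ + signedCut z (mergeOn T x z)) ≤
      -- The gain can only fail if the main term is small (`FA`), if one of the corrections from `z`
      -- and `x` is large (`FB`, `FD`), or if the cut has a large excess already for `x` (`FE`).
      (1 + ε) * (Fintype.card ι * Fintype.card τ + signedCut z x) + L).card ≤
      (((FA ∪ FB) ∪ FD) ∪ FE).card := by
    refine Finset.card_le_card_of_injOn (Equiv.curry ι τ Bool) ?_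
      (Equiv.injective _).injOn
    intro z hz
    by_contra hnot
    simp only [Finset.coe_union, Set.mem_union, Finset.mem_coe, not_or, FA, FB, FD, FE,
      Finset.mem_filter, Finset.mem_univ, true_and, not_le, not_lt, Equiv.curry_apply,
      Function.curry] at hnot
    obtain ⟨⟨⟨nA, nB⟩, nD⟩, nE⟩ := hnot
    simp only [Finset.coe_filter, Finset.mem_univ, true_and, Set.mem_ofPred_eq] at hz
    rw [signedCut_mergeOn, signedCut] at hz
    have bB := abs_lt.1 nB
    have bD := abs_lt.1 nD
    have bE := abs_lt.1 nE
    have hcur : ∀ i, Function.curry z i = fun t => z (i, t) := fun _ => rfl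
    simp only [Tr, hcur] at nA bB bD bE
    generalize ∑ i, Real.sign (rowSum fun t => z (i, t)) *
        ∑ t ∈ Finset.univ.filter fun t => (i, t) ∈ T, bitSign (z (i, t)) = b at *
    generalize ∑ i, Real.sign (rowSum fun t => z (i, t)) *
        ∑ t ∈ Finset.univ.filter fun t => (i, t) ∈ T, bitSign (x (i, t)) = d at *
    generalize ∑ i, Real.sign (rowSum fun t => z (i, t)) * ∑ t, bitSign (x (i, t)) = e at *
    have hrd : (Fintype.card ι : ℝ) * √(Fintype.card τ) = 32 * r := by rw [hrdef]; ring
    rw [hrd] at nA hL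
    generalize ∑ i, |rowSum fun t => z (i, t)| = a at *
    have hr0 : 0 < r := by rw [hrdef]; positivity
    -- Outside the bad events `a ≥ 16r` while `b`, `d`, `e` are below `r` in absolute value. The
    -- left side thus gains more than `7r`, against at most `2r` from `e` and `4r` from `hL`.
    have k1 : 1 / 2 * (a - b + d) ≤ (1 - ε) * (a - b + d) :=
      mul_le_mul_of_nonneg_right (by linarith) (by linarith)
    have k2 : (1 + ε) * e ≤ 2 * r := by nlinarith
    nlinarith
  have h4 : ((((FA ∪ FB) ∪ FD) ∪ FE).card : ℝ) ≤ FA.card + FB.card + FD.card + FE.card := by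
    have := Finset.card_union_le ((FA ∪ FB) ∪ FD) FE
    have := Finset.card_union_le (FA ∪ FB) FD
    have := Finset.card_union_le FA FB
    exact_mod_cast (by omega :
      (((FA ∪ FB) ∪ FD) ∪ FE).card ≤ FA.card + FB.card + FD.card + FE.card)
  refine (Nat.cast_le.2 hcard).trans (h4.trans ?_)
  linarith

end gain

/-! ### Inputs given by neighbour lists -/

/-- A graph given by its neighbour lists. -/
structure NeighborLists (V : Type*) where
  nb : V → List V
  nodup : ∀ v, (nb v).Nodup
  symm : ∀ {v w}, w ∈ nb v → v ∈ nb w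
  irrefl : ∀ v, v ∉ nb v

namespace NeighborLists

variable {V : Type*} [DecidableEq V]

/-- The input with these neighbour lists, after the vertices have been named by `e`. -/
def toOracle {n : ℕ} (L : NeighborLists V) (e : V ≃ Fin n) : GraphOracle n where
  graph :=
    { Adj := fun a b => e.symm b ∈ L.nb (e.symm a)
      symm := ⟨fun _ _ h => L.symm h⟩
      loopless := ⟨fun a => L.irrefl (e.symm a)⟩ }
  vert := Equiv.refl _
  deg a := (L.nb (e.symm a)).length
  nbr a := (List.Nodup.getEquiv _ (L.nodup (e.symm a))).trans
    (e.subtypeEquiv fun v => by simp [SimpleGraph.neighborSet])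

theorem toOracle_edgeAnswer {n : ℕ} (L : NeighborLists V) (e : V ≃ Fin n) (a : Fin n) (i : ℕ) :
    (L.toOracle e).edgeAnswer a i = ((L.nb (e.symm a))[i]?).map e := by
  unfold GraphOracle.edgeAnswer
  by_cases h : i < (L.nb (e.symm a)).length
  · have h' : i < (L.toOracle e).deg a := h
    rw [dif_pos h', List.getElem?_eq_getElem h]
    rfl
  · have h' : ¬ i < (L.toOracle e).deg a := h
    rw [dif_neg h', List.getElem?_eq_none (not_lt.1 h)]
    rfl

/-- The cut value in terms of the neighbour lists. -/
def cutValue (L : NeighborLists V) (U : Finset V) : ℝ :=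
  ∑ u ∈ U, ((L.nb u).map fun v => if v ∈ U then (0 : ℝ) else 1).sum

theorem cut_toOracle {n : ℕ} [Fintype V] (L : NeighborLists V) (e : V ≃ Fin n) (U : Finset V) :
    (WeightedGraph.ofSimpleGraph (L.toOracle e).graph).cut (U.map e.toEmbedding) =
      L.cutValue U := by
  unfold WeightedGraph.cut cutValue
  have hc : (U.map e.toEmbedding)ᶜ = Uᶜ.map e.toEmbedding := by
    ext a
    simp
  rw [hc, Finset.sum_map]
  refine Finset.sum_congr rfl fun u _ => ?_
  rw [Finset.sum_map, ← List.sum_toFinset _ (L.nodup u)]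
  have h1 : ∀ v, ((WeightedGraph.ofSimpleGraph (L.toOracle e).graph
      s(e.toEmbedding u, e.toEmbedding v) : ℝ≥0) : ℝ) = if v ∈ L.nb u then 1 else 0 := by
    intro v
    unfold WeightedGraph.ofSimpleGraph
    have : s(e.toEmbedding u, e.toEmbedding v) ∈ (L.toOracle e).graph.edgeSet ↔ v ∈ L.nb u := by
      rw [SimpleGraph.mem_edgeSet]
      simp [toOracle]
    by_cases hv : v ∈ L.nb u
    · rw [if_pos (this.2 hv), if_pos hv]; simp
    · rw [if_neg fun h => hv (this.1 h), if_neg hv]; simp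
  simp only [h1]
  rw [← Finset.sum_filter, Finset.sum_ite, Finset.sum_const_zero, zero_add]
  refine Finset.sum_congr ?_ fun _ _ => rfl
  ext v
  simp [and_comm]

/-- Add `m` vertices that form a complete graph. -/
noncomputable def pad (L : NeighborLists V) (m : ℕ) : NeighborLists (V ⊕ Fin m) where
  nb := Sum.elim (fun v => (L.nb v).map Sum.inl)
    fun j => ((Finset.univ.erase j).toList).map Sum.inr
  nodup := by
    rintro (v | j)
    · exact (L.nodup v).map Sum.inl_injective
    · exact (Finset.nodup_toList _).map Sum.inr_injective
  symm := by
    rintro (v | j) (w | k) h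
    · simp only [Sum.elim_inl, List.mem_map, Sum.inl.injEq, exists_eq_right] at h ⊢
      exact L.symm h
    · simp at h
    · simp at h
    · simp only [Sum.elim_inr, List.mem_map, Sum.inr.injEq, exists_eq_right, Finset.mem_toList,
        Finset.mem_erase, Finset.mem_univ, and_true] at h ⊢
      exact h.symm
  irrefl := by
    rintro (v | j)
    · simpa using L.irrefl v
    · simp

/-- No edge joins the added clique to the old vertices, so padding adjusts the number of vertices
without disturbing the cuts in use. -/
theorem cutValue_pad (L : NeighborLists V) (m : ℕ) (U : Finset V) :
    (L.pad m).cutValue (U.map Function.Embedding.inl) = L.cutValue U := by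
  unfold cutValue
  rw [Finset.sum_map]
  refine Finset.sum_congr rfl fun u _ => ?_
  simp [pad, Function.comp_def]

end NeighborLists

theorem GraphOracle.two_mul_ncard_edgeSet {n : ℕ} (I : GraphOracle n) :
    2 * I.graph.edgeSet.ncard = ∑ v, I.deg v := by
  classical
  have h := I.graph.sum_degrees_eq_twice_card_edges
  have hd : ∀ v, I.graph.degree v = I.deg v := fun v => by
    rw [← SimpleGraph.card_neighborSet_eq_degree, ← Fintype.card_congr (I.nbr v),
      Fintype.card_fin]
  simp only [hd] at h
  rw [h, ← SimpleGraph.coe_edgeFinset, Set.ncard_coe_finset]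

/-- A family of graphs, given by neighbour lists, in which every entry reveals at most one bit. -/
structure ListFamily (V B : Type*) where
  lists : (B → Bool) → NeighborLists V
  degTouch : V → Option B
  edgeTouch : V → ℕ → Option B
  length_eq : ∀ x y v, (∀ t ∈ degTouch v, x t = y t) →
    ((lists x).nb v).length = ((lists y).nb v).length
  getElem?_eq : ∀ x y v (i : ℕ), (∀ t ∈ edgeTouch v i, x t = y t) →
    ((lists x).nb v)[i]? = ((lists y).nb v)[i]?

namespace ListFamily

variable {V B : Type*} [DecidableEq V]

/-- The family of inputs after padding with a complete graph on `m` vertices. -/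
noncomputable def toSwitch {n m : ℕ} (F : ListFamily V B) (e : V ⊕ Fin m ≃ Fin n) : SwitchFamily n B where
  inst x := ((F.lists x).pad m).toOracle e
  degTouch a := Sum.elim F.degTouch (fun _ => none) (e.symm a)
  edgeTouch a i := Sum.elim (fun v => F.edgeTouch v i) (fun _ => none) (e.symm a)
  vert_eq _ _ := rfl
  deg_eq x y a h := by
    simp only [NeighborLists.toOracle, NeighborLists.pad]
    generalize e.symm a = v at *
    cases v with
    | inl v => simpa using F.length_eq x y v h
    | inr j => rfl
  edge_eq x y a i h := by
    rw [NeighborLists.toOracle_edgeAnswer, NeighborLists.toOracle_edgeAnswer]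
    simp only [NeighborLists.pad]
    generalize e.symm a = v at *
    cases v with
    | inl v => simp only [Sum.elim_inl, List.getElem?_map, F.getElem?_eq x y v i h]
    | inr j => rfl

/-- The copy of a set of vertices in the padded and renamed graph. -/
def image {n m : ℕ} (e : V ⊕ Fin m ≃ Fin n) (U : Finset V) : Finset (Fin n) :=
  (U.map Function.Embedding.inl).map e.toEmbedding

omit [DecidableEq V] in
theorem card_image {n m : ℕ} (e : V ⊕ Fin m ≃ Fin n) (U : Finset V) :
    (image e U).card = U.card := by
  simp [image]

theorem cut_image [Fintype V] {n m : ℕ} (F : ListFamily V B) (e : V ⊕ Fin m ≃ Fin n)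
    (x : B → Bool) (U : Finset V) :
    (WeightedGraph.ofSimpleGraph ((F.toSwitch e).inst x).graph).cut (image e U) =
      (F.lists x).cutValue U := by
  rw [← NeighborLists.cutValue_pad _ m]
  exact NeighborLists.cut_toOracle _ e _

theorem two_mul_ncard_edgeSet [Fintype V] {n m : ℕ} (F : ListFamily V B)
    (e : V ⊕ Fin m ≃ Fin n) (x : B → Bool) :
    2 * ((F.toSwitch e).inst x).graph.edgeSet.ncard =
      ∑ v, ((F.lists x).nb v).length + m * (m - 1) := by
  rw [GraphOracle.two_mul_ncard_edgeSet, ← Equiv.sum_comp e, Fintype.sum_sum_type]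
  simp [toSwitch, NeighborLists.toOracle, NeighborLists.pad]

theorem deg_pos {n m : ℕ} (F : ListFamily V B) (hm : 2 ≤ m)
    (e : V ⊕ Fin m ≃ Fin n) (x : B → Bool) (h : ∀ v, (F.lists x).nb v ≠ []) (a : Fin n) :
    0 < ((F.toSwitch e).inst x).deg a := by
  simp only [toSwitch, NeighborLists.toOracle, NeighborLists.pad]
  generalize e.symm a = v
  cases v with
  | inl v => simpa [List.length_pos_iff] using h v
  | inr j => simp; omega

end ListFamily

/-! ### Two-fold covers of complete bipartite graphs -/

section lift

variable {K P T C : Type*} [Fintype K] [DecidableEq K] [Fintype P] [DecidableEq P] [Fintype T]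
  [DecidableEq T] [Fintype C] [DecidableEq C]

/-- The vertices of a two-fold cover of `K` disjoint complete bipartite graphs with sides `P` and
`T × C`. -/
abbrev LiftVertex (K P T C : Type*) := ((K × P) × Bool) ⊕ ((K × (T × C)) × Bool)

/-- The neighbour lists of the two-fold cover in which the bit `x ((k, i), t)` tells whether the two
edges over an edge between `(k, i)` and `(k, (t, c))` are parallel or crossed. -/
noncomputable def liftNb (x : (K × P) × T → Bool) :
    LiftVertex K P T C → List (LiftVertex K P T C)
  | .inl (r, σ) => (Finset.univ : Finset (T × C)).toList.map
      fun tc => .inr ((r.1, tc), xor σ (x (r, tc.1)))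
  | .inr (l, σ) => (Finset.univ : Finset P).toList.map
      fun i => .inl ((l.1, i), xor σ (x ((l.1, i), l.2.1)))

variable (K P T C) in
/-- All two-fold covers of `K` disjoint complete bipartite graphs in which clones behave alike. -/
noncomputable def liftFamily : ListFamily (LiftVertex K P T C) ((K × P) × T) where
  lists x :=
    { nb := liftNb x
      nodup := by
        rintro (⟨r, σ⟩ | ⟨l, σ⟩)
        · refine (Finset.nodup_toList _).map fun a b h => ?_
          simp only [Sum.inr.injEq, Prod.mk.injEq, true_and] at h
          exact h.1
        · refine (Finset.nodup_toList _).map fun a b h => ?_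
          simp only [Sum.inl.injEq, Prod.mk.injEq, true_and] at h
          exact h.1
      symm := by
        rintro (⟨⟨k, i⟩, σ⟩ | ⟨⟨k, t, c⟩, σ⟩) (⟨⟨k', i'⟩, σ'⟩ | ⟨⟨k', t', c'⟩, σ'⟩) h
        · simp [liftNb] at h
        · simp only [liftNb, List.mem_map, Finset.mem_toList, Finset.mem_univ, true_and,
            Sum.inr.injEq, Prod.mk.injEq, Sum.inl.injEq, Prod.exists] at h ⊢
          obtain ⟨t, c, ⟨rfl, rfl, rfl⟩, rfl⟩ := h
          exact ⟨i, ⟨rfl, rfl⟩, by simp⟩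
        · simp only [liftNb, List.mem_map, Finset.mem_toList, Finset.mem_univ, true_and,
            Sum.inr.injEq, Prod.mk.injEq, Sum.inl.injEq, Prod.exists] at h ⊢
          obtain ⟨i, ⟨rfl, rfl⟩, rfl⟩ := h
          exact ⟨t, c, ⟨rfl, rfl, rfl⟩, by simp⟩
        · simp [liftNb] at h
      irrefl := by
        rintro (⟨r, σ⟩ | ⟨l, σ⟩) <;> simp [liftNb] }
  -- Crossing edges preserves all degrees, so degree queries reveal nothing.
  degTouch _ := none
  edgeTouch
    | .inl (r, _), j => ((Finset.univ : Finset (T × C)).toList[j]?).map fun tc => (r, tc.1)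
    | .inr (l, _), j => ((Finset.univ : Finset P).toList[j]?).map fun i => ((l.1, i), l.2.1)
  length_eq := by
    rintro x y (⟨r, σ⟩ | ⟨l, σ⟩) - <;> simp [liftNb]
  getElem?_eq := by
    rintro x y (⟨r, σ⟩ | ⟨l, σ⟩) j h
    · simp only [liftNb, List.getElem?_map]
      cases hj : (Finset.univ : Finset (T × C)).toList[j]? with
      | none => rfl
      | some tc => simp [h (r, tc.1) (by simp [hj])]
    · simp only [liftNb, List.getElem?_map]
      cases hj : (Finset.univ : Finset P).toList[j]? with
      | none => rfl
      | some i => simp [h ((l.1, i), l.2.1) (by simp [hj])]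

-- The total does not involve the bits, so all inputs of the family satisfy the same bounds on the
-- number of edges.
omit [DecidableEq K] [DecidableEq P] [DecidableEq T] [DecidableEq C] in
theorem sum_length_lift (x : (K × P) × T → Bool) :
    ∑ v, (((liftFamily K P T C).lists x).nb v).length =
      4 * (Fintype.card K * Fintype.card P * (Fintype.card T * Fintype.card C)) := by
  rw [Fintype.sum_sum_type]
  simp only [liftFamily, liftNb, List.length_map, Finset.length_toList, Finset.card_univ,
    Finset.sum_const, Fintype.card_prod, Fintype.card_bool, smul_eq_mul]
  ring

omit [Fintype K] [DecidableEq K] [DecidableEq P] [DecidableEq T] [DecidableEq C] in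
theorem lift_nb_ne_nil [Nonempty P] [Nonempty T] [Nonempty C] (x : (K × P) × T → Bool)
    (v : LiftVertex K P T C) : ((liftFamily K P T C).lists x).nb v ≠ [] := by
  rcases v with ⟨r, σ⟩ | ⟨l, σ⟩
  · simp [liftFamily, liftNb, Finset.univ_eq_empty_iff]
  · simp [liftFamily, liftNb, Finset.univ_eq_empty_iff]

omit [DecidableEq K] [DecidableEq P] [DecidableEq T] [DecidableEq C] in
theorem card_liftVertex : Fintype.card (LiftVertex K P T C) =
    2 * (Fintype.card K * (Fintype.card P + Fintype.card T * Fintype.card C)) := by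
  simp only [Fintype.card_sum, Fintype.card_prod, Fintype.card_bool]
  ring

/-- The vertices over `(k, i)` and `(k, (t, c))` in the sheets that satisfy `f` and `g`. -/
def liftSet (f : (K × P) → Bool → Prop) (g : (K × (T × C)) → Bool → Prop)
    [∀ r, DecidablePred (f r)] [∀ l, DecidablePred (g l)] : Finset (LiftVertex K P T C) :=
  (Finset.univ.filter fun r : (K × P) × Bool => f r.1 r.2).disjSum
    (Finset.univ.filter fun l : (K × (T × C)) × Bool => g l.1 l.2)

theorem cutValue_liftSet (x : (K × P) × T → Bool) (f : (K × P) → Bool → Prop)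
    (g : (K × (T × C)) → Bool → Prop) [∀ r, DecidablePred (f r)] [∀ l, DecidablePred (g l)] :
    ((liftFamily K P T C).lists x).cutValue (liftSet f g) =
    ∑ r : K × P, ∑ tc : T × C, ∑ σ : Bool,
      ((if f r σ then (if g (r.1, tc) (xor σ (x (r, tc.1))) then 0 else 1) else 0) +
       (if g (r.1, tc) σ then (if f r (xor σ (x (r, tc.1))) then 0 else 1) else 0) : ℝ) := by
  unfold NeighborLists.cutValue liftSet
  rw [Finset.sum_disjSum, Finset.sum_filter, Finset.sum_filter]
  simp only [liftFamily, liftNb, List.map_map, Function.comp_def, Finset.inl_mem_disjSum,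
    Finset.inr_mem_disjSum, Finset.mem_filter, Finset.mem_univ, true_and, Finset.sum_map_toList]
  simp only [Finset.sum_add_distrib]
  congr 1
  · rw [Fintype.sum_prod_type]
    refine Finset.sum_congr rfl fun r _ => ?_
    rw [Finset.sum_comm (s := (Finset.univ : Finset (T × C)))]
    refine Finset.sum_congr rfl fun σ _ => ?_
    split_ifs <;> simp
  · rw [Fintype.sum_prod_type, Fintype.sum_prod_type, Fintype.sum_prod_type]
    refine Finset.sum_congr rfl fun k _ => ?_
    rw [Finset.sum_comm (s := (Finset.univ : Finset P))]
    refine Finset.sum_congr rfl fun tc _ => ?_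
    rw [Finset.sum_comm (s := (Finset.univ : Finset P))]
    refine Finset.sum_congr rfl fun σ _ => ?_
    split_ifs <;> simp

/-- The cut that is optimal for the bits `z`. -/
noncomputable def optimalCut (z : (K × P) × T → Bool) : Finset (LiftVertex K P T C) :=
  liftSet (fun r σ => 0 < -bitSign σ * rowSum fun t => z (r, t)) fun _ τ => τ = false

/-- The two edges over one base edge are both cut or both uncut once a left sheet is chosen,
according to whether the bit of `x` agrees with the majority of `z`. This gives `1` plus or minus
`1` for each base edge. -/
theorem cutValue_optimalCut (x z : (K × P) × T → Bool) :
    ((liftFamily K P T C).lists x).cutValue (optimalCut z) =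
      Fintype.card C * (Fintype.card (K × P) * Fintype.card T + signedCut z x) := by
  rw [optimalCut, cutValue_liftSet]
  -- In a tie neither left vertex belongs to the set. Exactly one of the two edges is then cut, in
  -- accordance with `Real.sign 0 = 0`.
  have h : ∀ (r : K × P) (tc : T × C), (∑ σ : Bool,
      ((if 0 < -bitSign σ * rowSum (fun t => z (r, t)) then
        (if xor σ (x (r, tc.1)) = false then 0 else 1) else 0) +
       (if σ = false then (if 0 < -bitSign (xor σ (x (r, tc.1))) * rowSum (fun t => z (r, t))
        then 0 else 1) else 0) : ℝ)) =
      1 + Real.sign (rowSum fun t => z (r, t)) * bitSign (x (r, tc.1)) := by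
    intro r tc
    generalize rowSum (fun t => z (r, t)) = v
    generalize x (r, tc.1) = b
    rcases lt_trichotomy v 0 with hv | rfl | hv
    · have := hv.le
      cases b <;> simp [bitSign, hv, Real.sign_of_neg, not_lt.2 this, one_add_one_eq_two]
    · cases b <;> simp [bitSign]
    · have := hv.le
      cases b <;> simp [bitSign, hv, Real.sign_of_pos, not_lt.2 this, one_add_one_eq_two]
  simp only [h, Fintype.sum_prod_type (fun tc : T × C => _), Finset.sum_const, Finset.card_univ,
    nsmul_eq_mul, ← Finset.mul_sum]
  simp only [Finset.sum_add_distrib, signedCut, Finset.sum_const, Finset.card_univ,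
    nsmul_eq_mul, ← Finset.mul_sum]
  ring

omit [DecidableEq K] [DecidableEq P] [DecidableEq T] [DecidableEq C] in
theorem card_optimalCut_le (z : (K × P) × T → Bool) :
    (optimalCut z : Finset (LiftVertex K P T C)).card ≤
      Fintype.card (K × P) + Fintype.card K * (Fintype.card T * Fintype.card C) := by
  rw [optimalCut, liftSet, Finset.card_disjSum]
  refine add_le_add ?_ (le_of_eq ?_)
  · rw [← Finset.card_univ]
    refine Finset.card_le_card_of_injOn Prod.fst (fun _ _ => by simp) ?_
    rintro ⟨r, σ⟩ h ⟨r', σ'⟩ h' (rfl : r = r')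
    simp only [Finset.coe_filter, Finset.mem_univ, true_and, Set.mem_ofPred_eq] at h h'
    generalize rowSum (fun t => z (r, t)) = v at *
    cases σ <;> cases σ' <;> simp [bitSign] at h h' ⊢ <;> linarith
  · have : (Finset.univ.filter fun l : (K × (T × C)) × Bool => l.2 = false) =
        Finset.univ ×ˢ {false} := by
      ext ⟨l, σ⟩; simp
    rw [this, Finset.card_product]
    simp

/-- One of the two copies of a complete bipartite graph in the trivial cover. -/
def sheet (k : K) : Finset (LiftVertex K P T C) :=
  liftSet (fun r σ => r.1 = k ∧ σ = false) fun l σ => l.1 = k ∧ σ = false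

theorem cutValue_sheet_zero (k : K) :
    ((liftFamily K P T C).lists fun _ => false).cutValue (sheet k) = 0 := by
  rw [sheet, cutValue_liftSet]
  refine Finset.sum_eq_zero fun r _ => Finset.sum_eq_zero fun tc _ => ?_
  by_cases h : r.1 = k <;> simp [h]

/-- The flipped bit crosses two edges between the sheets, and one of them already suffices; all
other terms are nonnegative. -/
theorem one_le_cutValue_sheet_single [Nonempty C] (r : K × P) (t : T) :
    1 ≤ ((liftFamily K P T C).lists (SwitchFamily.single (r, t))).cutValue (sheet r.1) := by
  rw [sheet, cutValue_liftSet]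
  obtain ⟨c⟩ := ‹Nonempty C›
  have hpos : ∀ (r' : K × P) (tc : T × C), (0 : ℝ) ≤ ∑ σ : Bool,
      ((if r'.1 = r.1 ∧ σ = false then
        (if r'.1 = r.1 ∧ xor σ (SwitchFamily.single (r, t) (r', tc.1)) = false then 0 else 1)
        else 0) +
       (if r'.1 = r.1 ∧ σ = false then
        (if r'.1 = r.1 ∧ xor σ (SwitchFamily.single (r, t) (r', tc.1)) = false then 0 else 1)
        else 0) : ℝ) := fun r' tc => Finset.sum_nonneg fun σ _ => by split_ifs <;> norm_num
  refine le_trans ?_ (Finset.single_le_sum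
    (fun r' _ => Finset.sum_nonneg fun tc _ => hpos r' tc) (Finset.mem_univ r))
  refine le_trans ?_ (Finset.single_le_sum (fun tc _ => hpos r tc) (Finset.mem_univ (t, c)))
  simp [SwitchFamily.single]

omit [DecidableEq P] [DecidableEq T] [DecidableEq C] in
theorem card_sheet (k : K) : (sheet k : Finset (LiftVertex K P T C)).card =
    Fintype.card P + Fintype.card T * Fintype.card C := by
  have h1 : (Finset.univ.filter fun r : (K × P) × Bool => r.1.1 = k ∧ r.2 = false) =
      ({k} ×ˢ Finset.univ) ×ˢ {false} := by
    ext ⟨⟨k', i⟩, σ⟩; simp; intro _; exact eq_comm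
  have h2 : (Finset.univ.filter fun l : (K × (T × C)) × Bool => l.1.1 = k ∧ l.2 = false) =
      ({k} ×ˢ Finset.univ) ×ˢ {false} := by
    ext ⟨⟨k', i⟩, σ⟩; simp; intro _; exact eq_comm
  rw [sheet, liftSet, Finset.card_disjSum, h1, h2]
  simp

end lift

/-! ### Pairs with a hidden vertex of large degree -/

section hub

variable {ι D : Type*} [Fintype ι] [DecidableEq ι] [Fintype D] [DecidableEq D]

/-- The vertices of a graph in which one vertex of every pair `(i, _)` is joined to all of `D`, and
the other one to the single vertex `none`. -/
abbrev HubVertex (ι D : Type*) := (ι × Bool) ⊕ Option D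

/-- The neighbour lists of the graph in which `(i, x i)` is the vertex that is joined to `D`. -/
noncomputable def hubNb (x : ι → Bool) : HubVertex ι D → List (HubVertex ι D)
  | .inl (i, σ) => if σ = x i then
      (Finset.univ : Finset D).toList.map fun d => .inr (some d) else [.inr none]
  | .inr (some _) => (Finset.univ : Finset ι).toList.map fun i => .inl (i, x i)
  | .inr none => (Finset.univ : Finset ι).toList.map fun i => .inl (i, !x i)

variable (ι D) in
/-- All graphs in which one vertex of every pair has a large degree. -/
noncomputable def hubFamily : ListFamily (HubVertex ι D) ι where
  lists x :=
    { nb := hubNb x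
      nodup := by
        rintro (⟨i, σ⟩ | _ | d)
        · simp only [hubNb]
          split_ifs
          · refine (Finset.nodup_toList _).map fun a b h => ?_
            simpa using h
          · simp
        · refine (Finset.nodup_toList _).map fun a b h => ?_
          simp only [Sum.inl.injEq, Prod.mk.injEq] at h
          exact h.1
        · refine (Finset.nodup_toList _).map fun a b h => ?_
          simp only [Sum.inl.injEq, Prod.mk.injEq] at h
          exact h.1
      symm := by
        rintro (⟨i, σ⟩ | _ | d) (⟨i', σ'⟩ | _ | d') h <;> simp only [hubNb] at h ⊢
        · split_ifs at h <;> simp at h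
        · split_ifs at h with hx
          · simp at h
          · cases σ <;> cases hi : x i <;> simp_all
        · split_ifs at h with hx
          · simp [hx]
          · simp at h
        · simp only [List.mem_map, Finset.mem_toList, Finset.mem_univ, true_and, Sum.inl.injEq,
            Prod.mk.injEq] at h
          obtain ⟨j, rfl, rfl⟩ := h
          simp
        · simp at h
        · simp at h
        · simp only [List.mem_map, Finset.mem_toList, Finset.mem_univ, true_and, Sum.inl.injEq,
            Prod.mk.injEq] at h
          obtain ⟨j, rfl, rfl⟩ := h
          simp
        · simp at h
        · simp at h
      irrefl := by
        rintro (⟨i, σ⟩ | _ | d) <;> simp only [hubNb]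
        · split_ifs <;> simp
        · simp
        · simp }
  -- Unlike in the covers, a degree query at a vertex of a pair does reveal the bit, but only the
  -- bit of that pair.
  degTouch
    | .inl (i, _) => some i
    | .inr _ => none
  edgeTouch
    | .inl (i, _), _ => some i
    | .inr _, j => (Finset.univ : Finset ι).toList[j]?
  length_eq := by
    rintro x y (⟨i, σ⟩ | _ | d) h
    · simp only [hubNb, h i (by simp)]
    · simp [hubNb]
    · simp [hubNb]
  getElem?_eq := by
    rintro x y (⟨i, σ⟩ | _ | d) j h
    · simp only [hubNb, h i (by simp)]
    · simp only [hubNb, List.getElem?_map]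
      cases hj : (Finset.univ : Finset ι).toList[j]? with
      | none => rfl
      | some i => simp [h i (by simp [hj])]
    · simp only [hubNb, List.getElem?_map]
      cases hj : (Finset.univ : Finset ι).toList[j]? with
      | none => rfl
      | some i => simp [h i (by simp [hj])]

omit [DecidableEq ι] [DecidableEq D] in
theorem sum_length_hub (x : ι → Bool) :
    ∑ v, (((hubFamily ι D).lists x).nb v).length =
      2 * (Fintype.card ι * (Fintype.card D + 1)) := by
  rw [Fintype.sum_sum_type, Fintype.sum_prod_type, Fintype.sum_option]
  have h : ∀ i, ∑ σ : Bool, (hubNb (D := D) x (.inl (i, σ))).length = Fintype.card D + 1 := by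
    intro i
    cases hi : x i <;> simp [hubNb, hi, add_comm]
  simp only [hubFamily, h]
  simp [hubNb]
  ring

omit [DecidableEq ι] [DecidableEq D] in
theorem hub_nb_ne_nil [Nonempty ι] [Nonempty D] (x : ι → Bool)
    (v : HubVertex ι D) : ((hubFamily ι D).lists x).nb v ≠ [] := by
  rcases v with ⟨i, σ⟩ | _ | d
  · simp only [hubFamily, hubNb]
    split_ifs <;> simp [Finset.univ_eq_empty_iff]
  · simp [hubFamily, hubNb, Finset.univ_eq_empty_iff]
  · simp [hubFamily, hubNb, Finset.univ_eq_empty_iff]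

theorem cutValue_hub_zero (i : ι) :
    ((hubFamily ι D).lists fun _ => false).cutValue {.inl (i, true)} = 1 := by
  simp [NeighborLists.cutValue, hubFamily, hubNb]

theorem cutValue_hub_single (i : ι) :
    ((hubFamily ι D).lists (SwitchFamily.single i)).cutValue {.inl (i, true)} =
      Fintype.card D := by
  simp [NeighborLists.cutValue, hubFamily, hubNb, SwitchFamily.single, Function.comp_def]

end hub

/-! ### Query bounds for the three families -/

section bounds

variable {n m : ℕ} {Ω : Type*} [MeasurableSpace Ω] (μ : Measure Ω) [IsProbabilityMeasure μ]
  (A : RandQueryAlg n Ω) {ε δ Q : ℝ}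

/-- Lower bound from covers of a complete bipartite graph with sides `R` and `s * b`. -/
theorem le_queries_of_lift {R s b : ℕ} (hn : n = 2 * (R + s * b) + m) (hm : 2 ≤ m)
    (hs : 0 < s) (hb : 0 < b) (hRs : 16384 * s ≤ R) (hε0 : 0 ≤ ε) (hε : ε ≤ 1 / 2) (hδ : 0 ≤ δ)
    (hL : 2 * ε * (R * s) + δ * (R + s * b) / b ≤ R * √s / 8)
    (h : ∀ I : GraphOracle n, (∀ v, 0 < I.deg v) →
      2 * I.graph.edgeSet.ncard = 4 * (R * (s * b)) + m * (m - 1) →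
      IsProbCutSparsifier (3 / 4) ε δ I.graph μ (fun ω => (A.alg ω).run I) ∧
        ∫⁻ ω, ((A.alg ω).numQueries I : ENNReal) ∂μ < ENNReal.ofReal Q) :
    5 * (R * s : ℝ) / 16384 ≤ Q := by
  have : NeZero s := ⟨hs.ne'⟩
  have : NeZero b := ⟨hb.ne'⟩
  have : NeZero R := ⟨by omega⟩
  let F := liftFamily (Fin 1) (Fin R) (Fin s) (Fin b)
  let e : LiftVertex (Fin 1) (Fin R) (Fin s) (Fin b) ⊕ Fin m ≃ Fin n :=
    Fintype.equivFinOfCardEq (by rw [Fintype.card_sum, card_liftVertex]; simp [hn])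
  have hI : ∀ x, (∀ v, 0 < ((F.toSwitch e).inst x).deg v) ∧
      2 * ((F.toSwitch e).inst x).graph.edgeSet.ncard = 4 * (R * (s * b)) + m * (m - 1) := by
    refine fun x => ⟨F.deg_pos hm e x (lift_nb_ne_nil x), ?_⟩
    rw [F.two_mul_ncard_edgeSet e x, sum_length_lift]
    simp
  have hR0 : (0 : ℝ) < R := by exact_mod_cast Nat.pos_of_ne_zero (NeZero.ne R)
  have hs0 : (0 : ℝ) < s := by exact_mod_cast hs
  have hb0 : (0 : ℝ) < b := by exact_mod_cast hb
  have key := (F.toSwitch e).le_queries_of_resample_gap μ A (p := 3 / 4) (ε := ε) (δ := δ) (Q := Q)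
    (fun x => (h _ (hI x).1 (hI x).2).1) (fun x => (h _ (hI x).1 (hI x).2).2)
    (fun z => ListFamily.image e (optimalCut z)) (a := 3 / 16) (b := 1024 / (R * s))
    (by positivity) (by
      intro x T
      have hg := card_no_gain_le (ι := Fin 1 × Fin R) (τ := Fin s) (ε := ε)
        -- Cut values carry a common factor `b` for the clones, so dividing by it shrinks the
        -- additive error.
        (L := δ * (R + s * b) / b) (by simp; exact_mod_cast hRs) hε0 hε (by simpa using hL) x T
      simp only [Fintype.card_prod, Fintype.card_fin, one_mul] at hg
      refine le_trans ?_ hg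
      refine Nat.cast_le.2 (Finset.card_le_card fun z hz => ?_)
      simp only [Finset.mem_filter, Finset.mem_univ, true_and] at hz ⊢
      rw [F.cut_image, F.cut_image, cutValue_optimalCut, cutValue_optimalCut,
        ListFamily.card_image] at hz
      have hU : ((optimalCut z : Finset (LiftVertex (Fin 1) (Fin R) (Fin s) (Fin b))).card : ℝ) ≤
          R + s * b := by
        have := card_optimalCut_le (C := Fin b) z
        simp only [Fintype.card_prod, Fintype.card_fin, one_mul] at this
        exact_mod_cast this
      have hU' := mul_le_mul_of_nonneg_left hU hδ
      simp only [Fintype.card_prod, Fintype.card_fin, one_mul] at hz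
      refine le_of_mul_le_mul_left ?_ hb0
      have : (b : ℝ) * (δ * (R + s * b) / b) = δ * (R + s * b) := by field_simp
      rw [mul_add (b : ℝ), this]
      linarith)
  have : 1024 / (R * s : ℝ) * Q = 1024 * Q / (R * s) := by ring
  rw [this] at key
  -- The margin is `2 · 3/4 - 1 - 3/16 = 5/16`.
  have k2 : 5 / 16 ≤ 1024 * Q / (R * s : ℝ) := by linarith
  rw [le_div_iff₀ (by positivity)] at k2
  linarith

/-- Lower bound from pairs of copies of a complete bipartite graph, two edges of which may be
crossed. -/
theorem le_queries_of_sheets {K d : ℕ} (hn : n = 4 * (K * d) + m) (hm : 2 ≤ m)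
    (hd : 0 < d) (hε : ε ≤ 1) (hgap : δ * (2 * d) < 1 - ε)
    (h : ∀ I : GraphOracle n, (∀ v, 0 < I.deg v) →
      2 * I.graph.edgeSet.ncard = 4 * (K * d * d) + m * (m - 1) →
      IsProbCutSparsifier (3 / 4) ε δ I.graph μ (fun ω => (A.alg ω).run I) ∧
        ∫⁻ ω, ((A.alg ω).numQueries I : ENNReal) ∂μ < ENNReal.ofReal Q) :
    (K * d * d : ℝ) / 2 ≤ Q := by
  have : NeZero d := ⟨hd.ne'⟩
  let F := liftFamily (Fin K) (Fin d) (Fin d) (Fin 1)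
  let e : LiftVertex (Fin K) (Fin d) (Fin d) (Fin 1) ⊕ Fin m ≃ Fin n :=
    Fintype.equivFinOfCardEq (by
      rw [Fintype.card_sum, card_liftVertex]; simp only [Fintype.card_fin, hn]; ring)
  have hI : ∀ x, (∀ v, 0 < ((F.toSwitch e).inst x).deg v) ∧
      2 * ((F.toSwitch e).inst x).graph.edgeSet.ncard = 4 * (K * d * d) + m * (m - 1) := by
    refine fun x => ⟨F.deg_pos hm e x (lift_nb_ne_nil x), ?_⟩
    rw [F.two_mul_ncard_edgeSet e x, sum_length_lift]
    simp
  have key := (F.toSwitch e).le_queries_of_single_gap μ A (p := 3 / 4) (ε := ε) (δ := δ) (Q := Q)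
    (fun x => (h _ (hI x).1 (hI x).2).1) (h _ (hI _).1 (hI _).2).2
    (fun t => ListFamily.image e (sheet t.1.1)) (by
      rintro ⟨r, t⟩
      rw [F.cut_image, F.cut_image, cutValue_sheet_zero, ListFamily.card_image, card_sheet]
      have := one_le_cutValue_sheet_single (C := Fin 1) r t
      simp only [Fintype.card_fin, mul_one]
      push_cast
      have h2 := mul_le_mul_of_nonneg_left this (sub_nonneg.2 hε)
      simp only [F]
      linarith)
  simp only [Fintype.card_prod, Fintype.card_fin] at key
  push_cast at key
  linarith

/-- Lower bound from the search for vertices of large degree. -/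
theorem le_queries_of_hubs {R d : ℕ} (hn : n = 2 * R + (d + 1) + m) (hm : 2 ≤ m) (hR : 0 < R)
    (hd : 0 < d) (hgap : 1 + ε + δ < (1 - ε) * d)
    (h : ∀ I : GraphOracle n, (∀ v, 0 < I.deg v) →
      2 * I.graph.edgeSet.ncard = 2 * (R * (d + 1)) + m * (m - 1) →
      IsProbCutSparsifier (3 / 4) ε δ I.graph μ (fun ω => (A.alg ω).run I) ∧
        ∫⁻ ω, ((A.alg ω).numQueries I : ENNReal) ∂μ < ENNReal.ofReal Q) :
    (R : ℝ) / 2 ≤ Q := by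
  have : NeZero d := ⟨hd.ne'⟩
  have : NeZero R := ⟨hR.ne'⟩
  let F := hubFamily (Fin R) (Fin d)
  let e : HubVertex (Fin R) (Fin d) ⊕ Fin m ≃ Fin n :=
    Fintype.equivFinOfCardEq (by simp [hn]; ring)
  have hI : ∀ x, (∀ v, 0 < ((F.toSwitch e).inst x).deg v) ∧
      2 * ((F.toSwitch e).inst x).graph.edgeSet.ncard = 2 * (R * (d + 1)) + m * (m - 1) := by
    refine fun x => ⟨F.deg_pos hm e x (hub_nb_ne_nil x), ?_⟩
    rw [F.two_mul_ncard_edgeSet e x, sum_length_hub]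
    simp
  have key := (F.toSwitch e).le_queries_of_single_gap μ A (p := 3 / 4) (ε := ε) (δ := δ) (Q := Q)
    (fun x => (h _ (hI x).1 (hI x).2).1) (h _ (hI _).1 (hI _).2).2
    (fun i => ListFamily.image e {.inl (i, true)}) (by
      intro i
      rw [F.cut_image, F.cut_image, cutValue_hub_zero, cutValue_hub_single,
        ListFamily.card_image]
      simpa using hgap)
  simp only [Fintype.card_fin] at key
  linarith

end bounds

/-! ### Choice of sizes and the three regimes -/

/-- The choice of the sizes in the regime in which the multiplicative error dominates. -/
theorem exists_lift_sizes {n : ℕ} {ε δ u : ℝ} (hε0 : 0 < ε) (hδ0 : 0 < δ) (hεu : ε * u = 1)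
    (hu2 : 4096 ≤ u ^ 2) (hu0 : 0 < u) (hN : 2 ^ 20 * (u ^ 2 + δ * u) ≤ (n : ℝ)) :
    ∃ R s b m : ℕ, n = 2 * (R + s * b) + m ∧ 2 ≤ m ∧ m ≤ 3 ∧ 0 < s ∧ 0 < b ∧ 16384 * s ≤ R ∧
      (n * u ^ 2 : ℝ) / 2 ^ 15 ≤ (R * s : ℝ) ∧
      (R * (s * b) : ℝ) ≤ n / 2 * (δ * u + u ^ 2 / 4096) ∧
      2 * ε * (R * s) + δ * (R + s * b) / b ≤ R * √s / 8 := by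
  have hδu : 0 < δ * u := by positivity
  -- With `√s ≤ u / 64` the multiplicative loss `2εRs` stays below a quarter of the allowed `R√s /
  -- 8`, and `b ≥ 4096 δε` does the same for `δR / b`.
  set s : ℕ := ⌊u ^ 2 / 4096⌋₊ with hs
  set b : ℕ := ⌈4096 * (δ * ε)⌉₊ with hb
  have hs1 : 1 ≤ s := Nat.le_floor (by push_cast; linarith)
  have hsle : (s : ℝ) ≤ u ^ 2 / 4096 := Nat.floor_le (by positivity)
  have hslt : u ^ 2 / 4096 < s + 1 := Nat.lt_floor_add_one _
  have hs1' : (1 : ℝ) ≤ s := by exact_mod_cast hs1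
  have hsge : u ^ 2 / 8192 ≤ s := by linarith
  have hb1 : 0 < b := Nat.ceil_pos.2 (by positivity)
  have hb1' : (1 : ℝ) ≤ b := by exact_mod_cast hb1
  have hbge : 4096 * (δ * ε) ≤ b := Nat.le_ceil _
  have hble : (b : ℝ) < 4096 * (δ * ε) + 1 := Nat.ceil_lt_add_one (by positivity)
  have hsb : (s * b : ℝ) ≤ δ * u + u ^ 2 / 4096 := by
    calc (s * b : ℝ) ≤ u ^ 2 / 4096 * (4096 * (δ * ε) + 1) := by gcongr
      _ = (ε * u) * (δ * u) + u ^ 2 / 4096 := by ring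
      _ = _ := by rw [hεu, one_mul]
  have hsbn : ((s * b : ℕ) : ℝ) ≤ n / 2 ^ 20 := by
    push_cast
    rw [le_div_iff₀ (by positivity)]
    linarith
  have hnbig : (2 : ℝ) ^ 20 * 4096 ≤ n := by linarith
  -- The padding absorbs the parity of `n`; at least two vertices are needed since a single one
  -- would be isolated.
  obtain ⟨R, m, hnR, hm, hm3⟩ : ∃ R m : ℕ, n = 2 * (R + s * b) + m ∧ 2 ≤ m ∧ m ≤ 3 := by
    have h1 : ((2 * (s * b) + 3 : ℕ) : ℝ) ≤ n := by push_cast at hsbn ⊢; linarith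
    have h2 : 2 * (s * b) + 3 ≤ n := by exact_mod_cast h1
    refine ⟨(n - 2 - 2 * (s * b)) / 2, n - 2 * ((n - 2 - 2 * (s * b)) / 2 + s * b), ?_, ?_, ?_⟩ <;>
      omega
  have hnR' : (n : ℝ) = 2 * (R + s * b) + m := by exact_mod_cast hnR
  have hm' : (m : ℝ) ≤ 3 := by exact_mod_cast hm3
  push_cast at hsbn
  have hR : (n : ℝ) / 4 ≤ R := by linarith
  have hRn : (R : ℝ) ≤ n / 2 := by
    have h1 : (0 : ℝ) ≤ s * b := by positivity
    have h2 : (0 : ℝ) ≤ m := by positivity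
    linarith
  have hn0 : (0 : ℝ) < n := by linarith
  have hRs : (n * u ^ 2 : ℝ) / 2 ^ 15 ≤ (R * s : ℝ) := by
    calc (n * u ^ 2 : ℝ) / 2 ^ 15 = (n / 4) * (u ^ 2 / 8192) := by ring
      _ ≤ (R * s : ℝ) := by gcongr
  refine ⟨R, s, b, m, hnR, hm, hm3, hs1, hb1, ?_, hRs, by gcongr, ?_⟩
  · have : (16384 * s : ℝ) ≤ R := by linarith
    exact_mod_cast this
  set v := √(s : ℝ) with hv
  have hv0 : 0 ≤ v := Real.sqrt_nonneg _
  have hvv : v ^ 2 = s := Real.sq_sqrt (by positivity)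
  have hv1 : v ≤ u / 64 := by
    refine abs_le_of_sq_le_sq' ?_ (by positivity) |>.2
    rw [hvv]; linarith
  have hv2 : u / 128 ≤ v := by
    refine abs_le_of_sq_le_sq' ?_ hv0 |>.2
    rw [hvv]; linarith
  have hεv : ε * v ≤ 1 / 64 := by
    calc ε * v ≤ ε * (u / 64) := by gcongr
      _ = ε * u / 64 := by ring
      _ = 1 / 64 := by rw [hεu]
  have t1 : 2 * ε * (R * s) ≤ R * v / 32 := by
    rw [← hvv]
    calc 2 * ε * (R * v ^ 2) = 2 * (R * v) * (ε * v) := by ring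
      _ ≤ 2 * (R * v) * (1 / 64) := by gcongr
      _ = _ := by ring
  have t2 : δ * R / b ≤ R * v / 32 := by
    rw [div_le_iff₀ (by positivity)]
    calc δ * R = δ * R * (ε * u) := by rw [hεu, mul_one]
      _ = R * (u / 128) / 32 * (4096 * (δ * ε)) := by ring
      _ ≤ R * v / 32 * b := by gcongr
  -- The clones themselves count in `|U|`. Their share is controlled by the assumption that `n` is
  -- large compared with `δ / ε`.
  have t3 : δ * s ≤ R * v / 32 := by
    rw [← hvv]
    have : δ * v ≤ R / 32 := by
      have : δ * v ≤ δ * (u / 64) := by gcongr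
      have := sq_nonneg u
      linarith
    calc δ * v ^ 2 = δ * v * v := by ring
      _ ≤ R / 32 * v := by gcongr
      _ = R * v / 32 := by ring
  have t4 : δ * (R + s * b) / b = δ * R / b + δ * s := by field_simp
  rw [t4]
  have : 0 ≤ R * v := by positivity
  linarith

section regimes

variable {n : ℕ} {Ω : Type*} [MeasurableSpace Ω] (μ : Measure Ω) [IsProbabilityMeasure μ]
  (A : RandQueryAlg n Ω) {ε δ c C θ : ℝ}

/-- The regime in which the multiplicative error is small and dominates. -/
theorem false_of_fast_of_small_eps (hε0 : 0 < ε) (hε : ε ≤ 1 / 64) (hδ : ε ^ 2 ≤ δ)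
    (hc0 : 0 < c) (hc : c ≤ 1 / 2 ^ 30) (hC : 2 ^ 20 ≤ C)
    (hn : C * (1 / ε ^ 2 + 1 / δ + δ / ε) ≤ n)
    (h : ∀ I : GraphOracle n, (∀ v, 0 < I.deg v) →
      c * (n / ε ^ 2 + n / δ) ≤ (I.graph.edgeSet.ncard : ℝ) →
      (I.graph.edgeSet.ncard : ℝ) ≤ C * (n / ε ^ 2 + n / δ + n * δ / ε) →
      IsProbCutSparsifier (3 / 4) ε δ I.graph μ (fun ω => (A.alg ω).run I) ∧
        ∫⁻ ω, ((A.alg ω).numQueries I : ENNReal) ∂μ <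
          ENNReal.ofReal (c * (n / ε ^ 2 + n / δ))) : False := by
  obtain ⟨u, hu⟩ : ∃ u, u = 1 / ε := ⟨_, rfl⟩
  obtain ⟨w, hw⟩ : ∃ w, w = 1 / δ := ⟨_, rfl⟩
  have hδ0 : 0 < δ := lt_of_lt_of_le (by positivity) hδ
  have hεu : ε * u = 1 := by rw [hu]; field_simp
  have hu64 : 64 ≤ u := by rw [hu, le_div_iff₀ hε0]; linarith
  have hw0 : 0 < w := by rw [hw]; positivity
  have hwu : w ≤ u ^ 2 := by
    rw [hw, hu, one_div_pow]; exact one_div_le_one_div_of_le (by positivity) hδ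
  have e1 : 1 / ε ^ 2 = u ^ 2 := by rw [hu, one_div_pow]
  have e2 : (n : ℝ) / ε ^ 2 = n * u ^ 2 := by rw [← e1]; ring
  have e3 : (n : ℝ) / δ = n * w := by rw [hw]; ring
  have e4 : δ / ε = δ * u := by rw [hu]; ring
  have e5 : (n : ℝ) * δ / ε = n * (δ * u) := by rw [hu]; ring
  rw [e1, ← hw, e4] at hn
  rw [e2, e3, e5] at h
  have hδu : 0 < δ * u := by positivity
  have hN : 2 ^ 20 * (u ^ 2 + δ * u) ≤ (n : ℝ) := by
    refine le_trans ?_ hn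
    gcongr
    linarith
  have hu2 : 4096 ≤ u ^ 2 := by nlinarith
  have hn1 : (1 : ℝ) ≤ n := by linarith
  have hn0 : (0 : ℝ) < n := by linarith
  have hnu2 : 1 * 4096 ≤ n * u ^ 2 := mul_le_mul hn1 hu2 (by norm_num) hn0.le
  obtain ⟨R, s, b, m, hnR, hm, hm3, hs1, hb1, hRs16, hRs, hRsb, hL⟩ :=
    exists_lift_sizes (n := n) hε0 hδ0 hεu hu2 (by linarith) hN
  have hb1' : (1 : ℝ) ≤ b := by exact_mod_cast hb1
  have hnu : 0 < (n : ℝ) * u ^ 2 := by positivity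
  have hQ : c * (n * u ^ 2 + n * w) ≤ n * u ^ 2 / 2 ^ 29 := by
    calc c * (n * u ^ 2 + n * w) ≤ 1 / 2 ^ 30 * (n * u ^ 2 + n * u ^ 2) := by gcongr
      _ = _ := by ring
  have key := le_queries_of_lift μ A (ε := ε) (δ := δ) (Q := c * (n * u ^ 2 + n * w)) hnR hm
    hs1 hb1 hRs16 hε0.le (by linarith) hδ0.le hL (by
      intro I hdeg hE
      have hEr : 2 * (I.graph.edgeSet.ncard : ℝ) = 4 * (R * (s * b)) + ((m * (m - 1) : ℕ) : ℝ) := by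
        exact_mod_cast hE
      have hmm : m * (m - 1) ≤ 6 := by
        calc m * (m - 1) ≤ 3 * 2 := Nat.mul_le_mul hm3 (by omega)
          _ = 6 := rfl
      have hmm' : ((m * (m - 1) : ℕ) : ℝ) ≤ 6 := by exact_mod_cast hmm
      have hmm0 : (0 : ℝ) ≤ ((m * (m - 1) : ℕ) : ℝ) := by positivity
      refine h I hdeg (hQ.trans ?_) ?_
      · have : (R * s : ℝ) ≤ R * (s * b) := by
          rw [← mul_assoc]
          exact le_mul_of_one_le_right (by positivity) hb1'
        linarith
      · have h2 : (1 : ℝ) * (n * u ^ 2 + n * w + n * (δ * u)) ≤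
            C * (n * u ^ 2 + n * w + n * (δ * u)) := by
          gcongr
          linarith
        have h3 : (0 : ℝ) < n * w := by positivity
        have h4 : (0 : ℝ) < n * (δ * u) := by positivity
        linarith)
  -- `key` and `hRs` give `Q ≥ 5 n u² / 2 ^ 29`, against `hQ`.
  linarith

/-- The regime in which the additive error is small and dominates. -/
theorem false_of_fast_of_small_delta (hε0 : 0 < ε) (hδ0 : 0 < δ) (hδ : δ ≤ ε ^ 2)
    (hθ0 : 0 < θ) (hθ1 : θ ≤ 1) (hθ : θ ≤ 1 - ε) (hδθ : δ ≤ θ / 4)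
    (hc0 : 0 < c) (hc : c ≤ θ / 2 ^ 30) (hC : 2 ^ 20 ≤ C)
    (hn : C * (1 / ε ^ 2 + 1 / δ + δ / ε) ≤ n)
    (h : ∀ I : GraphOracle n, (∀ v, 0 < I.deg v) →
      c * (n / ε ^ 2 + n / δ) ≤ (I.graph.edgeSet.ncard : ℝ) →
      (I.graph.edgeSet.ncard : ℝ) ≤ C * (n / ε ^ 2 + n / δ + n * δ / ε) →
      IsProbCutSparsifier (3 / 4) ε δ I.graph μ (fun ω => (A.alg ω).run I) ∧
        ∫⁻ ω, ((A.alg ω).numQueries I : ENNReal) ∂μ <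
          ENNReal.ofReal (c * (n / ε ^ 2 + n / δ))) : False := by
  obtain ⟨w, hw⟩ : ∃ w, w = 1 / δ := ⟨_, rfl⟩
  obtain ⟨x, hx⟩ : ∃ x, x = 1 / ε ^ 2 := ⟨_, rfl⟩
  have hw0 : 0 < w := by rw [hw]; positivity
  have hδw : δ * w = 1 := by rw [hw]; field_simp
  have hx0 : 0 < x := by rw [hx]; positivity
  have hxw : x ≤ w := by rw [hx, hw]; exact one_div_le_one_div_of_le hδ0 hδ
  have hθw : 4 ≤ θ * w := by nlinarith
  have e2 : (n : ℝ) / ε ^ 2 = n * x := by rw [hx]; ring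
  have e3 : (n : ℝ) / δ = n * w := by rw [hw]; ring
  rw [← hx, ← hw] at hn
  rw [e2, e3] at h
  have hN : 2 ^ 20 * w ≤ (n : ℝ) := by
    refine le_trans ?_ hn
    have : 0 ≤ δ / ε := by positivity
    gcongr
    linarith
  have hθww : θ * w ≤ w := mul_le_of_le_one_left hw0.le hθ1
  -- This makes the additive error `2dδ` of a sheet at most `θ / 2`, below `1 - ε`.
  set d : ℕ := ⌊θ * w / 4⌋₊ with hd
  have hd1 : 1 ≤ d := Nat.le_floor (by push_cast; linarith)
  have hd1' : (1 : ℝ) ≤ d := by exact_mod_cast hd1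
  have hdle : (d : ℝ) ≤ θ * w / 4 := Nat.floor_le (by positivity)
  have hdlt : θ * w / 4 < d + 1 := Nat.lt_floor_add_one _
  have hdge : θ * w / 8 ≤ d := by linarith
  obtain ⟨K, m, hnK, hm, hmd⟩ : ∃ K m : ℕ, n = 4 * (K * d) + m ∧ 2 ≤ m ∧ m ≤ 4 * d + 1 := by
    have h1 : (2 : ℝ) ≤ n := by linarith
    have h2 : 2 ≤ n := by exact_mod_cast h1
    have h3 := Nat.div_add_mod (n - 2) (4 * d)
    have h4 := Nat.mod_lt (n - 2) (y := 4 * d) (by omega)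
    refine ⟨(n - 2) / (4 * d), (n - 2) % (4 * d) + 2, ?_, by omega, by omega⟩
    have : 4 * ((n - 2) / (4 * d) * d) = 4 * d * ((n - 2) / (4 * d)) := by ring
    omega
  have hnK' : (n : ℝ) = 4 * (K * d) + m := by exact_mod_cast hnK
  have hm' : (m : ℝ) ≤ 4 * d + 1 := by exact_mod_cast hmd
  have hKd : (n : ℝ) / 8 ≤ K * d := by linarith
  have hn0 : (0 : ℝ) < n := by linarith
  have hKd' : (K * d : ℝ) ≤ n / 4 := by
    have : (0 : ℝ) ≤ m := by positivity
    linarith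
  have hKdd : n * (θ * w) / 64 ≤ (K * d * d : ℝ) := by
    calc n * (θ * w) / 64 = n / 8 * (θ * w / 8) := by ring
      _ ≤ K * d * d := by gcongr
  have hnw : 0 < (n : ℝ) * (θ * w) := by positivity
  have hQ : c * (n * x + n * w) ≤ n * (θ * w) / 2 ^ 29 := by
    calc c * (n * x + n * w) ≤ θ / 2 ^ 30 * (n * w + n * w) := by gcongr
      _ = _ := by ring
  have key := le_queries_of_sheets μ A (ε := ε) (δ := δ) (Q := c * (n * x + n * w)) hnK hm hd1
    (by linarith) (by
      have : δ * (2 * d) ≤ δ * (2 * (θ * w / 4)) := by gcongr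
      have e : δ * (2 * (θ * w / 4)) = (δ * w) * θ / 2 := by ring
      rw [e, hδw] at this
      linarith) (by
      intro I hdeg hE
      have hEr : 2 * (I.graph.edgeSet.ncard : ℝ) =
          4 * (K * d * d) + ((m * (m - 1) : ℕ) : ℝ) := by
        exact_mod_cast hE
      have hmm0 : (0 : ℝ) ≤ ((m * (m - 1) : ℕ) : ℝ) := by positivity
      -- Here the padding clique takes the remainder modulo `4d` and can be large, but it adds only
      -- order `nd` edges.
      have hmm : m * (m - 1) ≤ n * (4 * d) := Nat.mul_le_mul (by omega) (by omega)
      have hmm' : ((m * (m - 1) : ℕ) : ℝ) ≤ n * (4 * d) := by exact_mod_cast hmm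
      refine h I hdeg (hQ.trans (by linarith)) ?_
      have h1 : (K * d * d : ℝ) ≤ n / 4 * d := by gcongr
      have h2 : (n * d : ℝ) ≤ n * (w / 4) := by
        gcongr
        linarith
      have h3 : (1 : ℝ) * (n * x + n * w + n * δ / ε) ≤ C * (n * x + n * w + n * δ / ε) := by
        gcongr
        linarith
      have h4 : (0 : ℝ) < n * x := by positivity
      have h5 : (0 : ℝ) < n * δ / ε := by positivity
      have h6 : (0 : ℝ) < n * w := by positivity
      linarith)
  linarith

/-- The regime in which neither error is small. -/
theorem false_of_fast_of_large (hε0 : 0 < ε) (hδ0 : 0 < δ)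
    (hθ0 : 0 < θ) (hθ : θ ≤ 1 - ε) (hεθ : θ / 4096 ≤ ε ^ 2) (hδθ : θ / 4096 ≤ δ)
    (hc0 : 0 < c) (hc : c ≤ θ / 2 ^ 30) (hC : 2 ^ 20 / θ ≤ C)
    (hn : C * (1 / ε ^ 2 + 1 / δ + δ / ε) ≤ n)
    (h : ∀ I : GraphOracle n, (∀ v, 0 < I.deg v) →
      c * (n / ε ^ 2 + n / δ) ≤ (I.graph.edgeSet.ncard : ℝ) →
      (I.graph.edgeSet.ncard : ℝ) ≤ C * (n / ε ^ 2 + n / δ + n * δ / ε) →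
      IsProbCutSparsifier (3 / 4) ε δ I.graph μ (fun ω => (A.alg ω).run I) ∧
        ∫⁻ ω, ((A.alg ω).numQueries I : ENNReal) ∂μ <
          ENNReal.ofReal (c * (n / ε ^ 2 + n / δ))) : False := by
  have hε1 : ε ≤ 1 := by linarith
  have hx1 : 1 ≤ 1 / ε ^ 2 := by
    rw [le_div_iff₀ (by positivity)]; nlinarith
  have hδε : δ ≤ δ / ε := by
    rw [le_div_iff₀ hε0]; nlinarith
  have hw0 : 0 < 1 / δ := by positivity
  have hC0 : 0 < C := lt_of_lt_of_le (by positivity) hC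
  set y : ℝ := (1 + δ) / θ with hy
  have hθy : θ * y = 1 + δ := by rw [hy]; field_simp
  have hy0 : 0 < y := by rw [hy]; positivity
  have hy1 : 1 ≤ y := by rw [hy, le_div_iff₀ hθ0]; linarith
  have hCy : 2 ^ 20 * y ≤ C * (1 / ε ^ 2 + 1 / δ + δ / ε) := by
    calc 2 ^ 20 * y = 2 ^ 20 / θ * (1 + δ) := by rw [hy]; ring
      _ ≤ C * (1 / ε ^ 2 + 1 / δ + δ / ε) := by gcongr; linarith
  have hN := hCy.trans hn
  have hn0 : (0 : ℝ) < n := by linarith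
  -- Then `(1 - ε) d ≥ 3θy = 3(1 + δ)`, which exceeds `1 + ε + δ`. The degree grows with `δ`; the
  -- term `nδ / ε` in the edge bound pays for this.
  set d : ℕ := ⌈3 * y⌉₊ with hd
  have hdge : 3 * y ≤ d := Nat.le_ceil _
  have hdle : (d : ℝ) < 3 * y + 1 := Nat.ceil_lt_add_one (by positivity)
  obtain ⟨R, m, hnR, hm, hm3⟩ : ∃ R m : ℕ, n = 2 * R + (d + 1) + m ∧ 2 ≤ m ∧ m ≤ 3 := by
    have h1 : ((d + 4 : ℕ) : ℝ) ≤ n := by push_cast; linarith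
    have h2 : d + 4 ≤ n := by exact_mod_cast h1
    refine ⟨(n - (d + 3)) / 2, n - (2 * ((n - (d + 3)) / 2) + (d + 1)), ?_, ?_, ?_⟩ <;> omega
  have hnR' : (n : ℝ) = 2 * R + (d + 1) + m := by exact_mod_cast hnR
  have hm' : (m : ℝ) ≤ 3 := by exact_mod_cast hm3
  have hR : (n : ℝ) / 4 ≤ R := by linarith
  have hRn : (R : ℝ) ≤ n / 2 := by
    have : (0 : ℝ) ≤ m := by positivity
    linarith
  have hQ : c * (n / ε ^ 2 + n / δ) ≤ n / 16 := by
    calc c * ((n : ℝ) / ε ^ 2 + n / δ) ≤ θ / 2 ^ 30 * (n / (θ / 4096) + n / (θ / 4096)) := by gcongr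
      _ = (n : ℝ) / 2 ^ 17 := by field_simp; ring
      _ ≤ (n : ℝ) / 16 := by gcongr; norm_num
  have key := le_queries_of_hubs μ A (ε := ε) (δ := δ) (Q := c * (n / ε ^ 2 + n / δ)) hnR hm
    (by
      have : (0 : ℝ) < R := by linarith
      exact_mod_cast this)
    (by
      have : (0 : ℝ) < d := by linarith
      exact_mod_cast this)
    (by
      have : θ * (3 * y) ≤ (1 - ε) * d := by gcongr
      nlinarith) (by
      intro I hdeg hE
      have hEr : 2 * (I.graph.edgeSet.ncard : ℝ) =
          2 * (R * (d + 1)) + ((m * (m - 1) : ℕ) : ℝ) := by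
        exact_mod_cast hE
      have hmm : m * (m - 1) ≤ 6 := by
        calc m * (m - 1) ≤ 3 * 2 := Nat.mul_le_mul hm3 (by omega)
          _ = 6 := rfl
      have hmm' : ((m * (m - 1) : ℕ) : ℝ) ≤ 6 := by exact_mod_cast hmm
      have hmm0 : (0 : ℝ) ≤ ((m * (m - 1) : ℕ) : ℝ) := by positivity
      have hRd : (0 : ℝ) ≤ R * d := by positivity
      refine h I hdeg (hQ.trans (by linarith)) ?_
      have h1 : (R * (d + 1) : ℝ) ≤ n / 2 * (3 * y + 2) :=
        mul_le_mul hRn (by linarith) (by positivity) (by positivity)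
      have h2 : n * (2 ^ 20 * y) ≤ n * (C * (1 / ε ^ 2 + 1 / δ + δ / ε)) := by gcongr
      have e : n * (C * (1 / ε ^ 2 + 1 / δ + δ / ε)) =
          C * (n / ε ^ 2 + n / δ + n * δ / ε) := by ring
      rw [e] at h2
      have h3 : (n : ℝ) ≤ n * y := by nlinarith
      linarith)
  linarith

end regimes

/-! ### The lower bound -/

theorem theorem4p2 :
    ∃ p : ℝ, 0 < p ∧ p < 1 ∧ ∀ ε₁ : ℝ, ε₁ < 1 → ∃ c C : ℝ, 0 < c ∧ 0 < C ∧
      ∀ ε δ : ℝ, 0 < ε → ε ≤ ε₁ → 0 < δ →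
      ∀ n : ℕ, C * (1 / ε ^ 2 + 1 / δ + δ / ε) ≤ (n : ℝ) →
      ∀ (Ω : Type*) [MeasurableSpace Ω] (μ : Measure Ω) [IsProbabilityMeasure μ]
        (A : RandQueryAlg n Ω),
        (∀ I ∈ sparseInputs n (c * (n / ε ^ 2 + n / δ)) (C * (n / ε ^ 2 + n / δ + n * δ / ε)),
          IsProbCutSparsifier p ε δ I.graph μ fun ω => (A.alg ω).run I) →
        ∃ I ∈ sparseInputs n (c * (n / ε ^ 2 + n / δ)) (C * (n / ε ^ 2 + n / δ + n * δ / ε)),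
          ENNReal.ofReal (c * (n / ε ^ 2 + n / δ)) ≤
            ∫⁻ ω, ((A.alg ω).numQueries I : ENNReal) ∂μ := by
  refine ⟨3 / 4, by norm_num, by norm_num, fun ε₁ hε₁ => ?_⟩
  rcases le_or_gt ε₁ 0 with h0 | h0
  · exact ⟨1, 1, one_pos, one_pos, fun ε δ hε hε' => absurd (hε.trans_le hε') (not_lt.2 h0)⟩
  obtain ⟨θ, hθ⟩ : ∃ θ, θ = 1 - ε₁ := ⟨_, rfl⟩
  have hθ0 : 0 < θ := by linarith
  have hθ1 : θ ≤ 1 := by linarith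
  refine ⟨θ / 2 ^ 30, 2 ^ 20 / θ, by positivity, by positivity, ?_⟩
  intro ε δ hε0 hε hδ0 n hn Ω _ μ _ A hA
  by_contra! H
  have hall := fun I (h1 : ∀ v, 0 < GraphOracle.deg I v) h2 h3 =>
    And.intro (hA I ⟨h1, h2, h3⟩) (H I ⟨h1, h2, h3⟩)
  have hc0 : 0 < θ / 2 ^ 30 := by positivity
  have hC : 2 ^ 20 ≤ 2 ^ 20 / θ := le_div_self (by positivity) hθ0 hθ1
  -- The comparison of `ε ^ 2` with `δ` decides which term dominates. If the dominating error is not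
  -- small, the other comparison bounds both errors below, and the hubs apply.
  rcases le_total (ε ^ 2) δ with hδε | hδε
  · rcases le_total ε (1 / 64) with hs | hs
    · exact false_of_fast_of_small_eps μ A hε0 hs hδε hc0 (by gcongr) hC hn hall
    · have hε2 : 1 / 4096 ≤ ε ^ 2 := by nlinarith
      exact false_of_fast_of_large μ A hε0 hδ0 hθ0 (by linarith) (by linarith) (by linarith)
        hc0 le_rfl le_rfl hn hall
  · rcases le_total δ (θ / 4) with hs | hs
    · exact false_of_fast_of_small_delta μ A hε0 hδ0 hδε hθ0 hθ1 (by linarith) hs hc0 le_rfl hC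
        hn hall
    · exact false_of_fast_of_large μ A hε0 hδ0 hθ0 (by linarith) (by linarith) (by linarith)
        hc0 le_rfl le_rfl hn hall
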